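/- Let $\beta>1$ and let $a_\beta\colon\mathbb R^2\to\{1,\beta\}$ be equal to $\beta$ on the open dark squares $(i,i+1)\times(h,h+1)$ with $i,h\in\mathbb Z$, $i+h$ odd, and equal to $1$ elsewhere (the standard chessboard structure). The optical length of an absolutely continuous curve $u\colon[0,1]\to\mathbb R^2$ is $\int_0^1 a_\beta(u(t))\,|u'(t)|\,dt$, and a geodesic from $P$ to $Q$ is the support $\Gamma=u([0,1])$ of a curve $u$ of minimal optical length among all absolutely continuous curves from $P$ to $Q$. For $k\in\mathbb Z$ the light diagonal $D_k$ is the line $y=x-2k$; a light vertex is a point with integer coordinates lying on a light diagonal. For integers $p\ge 1$, $q\ge 0$ let $\sigma\in(-1,1)$ be the unique solution of $\frac{p\,\sigma}{\sqrt{1-\sigma^2}}+\frac{q\,\sigma}{\sqrt{\beta^2-\sigma^2}}=1$ and let $\Lambda_\beta(p,q)=\frac{p}{\sqrt{1-\sigma^2}}+\frac{\beta^2 q}{\sqrt{\beta^2-\sigma^2}}$; this is the optical length of the Snell path of height $1$ crossing vertical strips of light and dark material of total thickness $p$ and $q$. Let $\beta^c_0$ be the unique $\beta\in(1,\sqrt2)$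 such that $\Lambda_\beta(2,1)-\Lambda_\beta(1,0)=2$; equivalently, the Snell path from $(0,0)$ to $(3,1)$ has optical length $2+\sqrt2$. **Theorem 4.1.** Assume $\beta>\beta^c_0$, let $n,j\ge 1$ be integers and let $\Gamma$ be a geodesic from $O=(0,0)$ to the light vertex $(2n+j,j)$. Then for every $k=0,\dots,n$ the intersection $\Gamma\cap D_k$ is a (possibly degenerate) segment $[A_k,B_k]$ whose endpoints $A_k$ and $B_k$ are light vertices, with ordinates $0\le y_{A_k}\le y_{B_k}\le j$; moreover $A_0=O$ and $B_n=(2n+j,j)$. For every $k=1,\dots,n$ the segment $[B_{k-1},A_k]$ is horizontal and contained in $\Gamma$. Consequently $$\Gamma=\bigcup_{k=0}^{n}[A_k,B_k]\ \cup\ \bigcup_{k=1}^{n}[B_{k-1},A_k],$$ so that $\Gamma$ runs only along horizontal sides of the squares and light diagonals. -/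

import Mathlib

noncomputable section

namespace Chessboard

/-- The plane with its Euclidean norm; `P 0` and `P 1` are the coordinates `x` and `y`. -/
abbrev Plane : Type := EuclideanSpace ℝ (Fin 2)

/-- The union of the open dark squares `(i, i + 1) × (j, j + 1)`, `i + j` odd. This is the
extension, with period `2` in both variables, of `(0, 1) × (1, 2) ∪ (1, 2) × (0, 1)`. -/
def darkRegion : Set Plane :=
  {P | ∃ i j : ℤ, Odd (i + j) ∧ P 0 ∈ Set.Ioo (i : ℝ) (i + 1) ∧ P 1 ∈ Set.Ioo (j : ℝ) (j + 1)}

open Classical in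
/-- The refractive index `a_β` of the standard chessboard structure: `β` inside the dark squares,
`1` elsewhere (in particular on all the sides of the squares). -/
def refractiveIndex (β : ℝ) (P : Plane) : ℝ :=
  if P ∈ darkRegion then β else 1

/-- The optical length `∫₀¹ a_β(u(t)) |u'(t)| dt` of a curve `u`, used for absolutely continuous
curves, for which the derivative exists almost everywhere and the integrand is integrable. -/
def opticalLength (β : ℝ) (u : ℝ → Plane) : ℝ :=
  ∫ t in (0 : ℝ)..1, refractiveIndex β (u t) * ‖deriv u t‖

/-- `u` is an absolutely continuous curve, parametrized on `[0, 1]`, from `P` to `Q`. -/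
structure IsCurve (P Q : Plane) (u : ℝ → Plane) : Prop where
  absolutelyContinuous : AbsolutelyContinuousOnInterval u 0 1
  source : u 0 = P
  target : u 1 = Q

/-- `Γ` is a geodesic from `P` to `Q`: the support of a curve of minimal optical length among all
the absolutely continuous curves from `P` to `Q`. -/
def IsGeodesic (β : ℝ) (P Q : Plane) (Γ : Set Plane) : Prop :=
  ∃ u : ℝ → Plane, IsCurve P Q u ∧
    (∀ v : ℝ → Plane, IsCurve P Q v → opticalLength β u ≤ opticalLength β v) ∧
    Γ = u '' Set.Icc 0 1

/-- The light diagonal `D_n`, of equation `y = x - 2 n`. -/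
def lightDiagonal (n : ℤ) : Set Plane := {P | P 1 = P 0 - 2 * n}

/-- A light vertex: a point with integer coordinates on a light diagonal. -/
def IsLightVertex (P : Plane) : Prop :=
  (∃ a b : ℤ, P 0 = a ∧ P 1 = b) ∧ ∃ n : ℤ, P ∈ lightDiagonal n

/-- For a Snell path of height `h` crossing vertical strips of light and dark material of total
thickness `p` and `q`, the sine `σ` of the angle of incidence in the light material: the solution
`σ ∈ (-1, 1)` of `p σ / √(1 - σ²) + q σ / √(β² - σ²) = h`. For `p > 0`, `q ≥ 0`, `β ≥ 1` the
left-hand side is strictly increasing from `-∞` to `+∞`, so the set below is a singleton. -/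
def snellSine (β p q h : ℝ) : ℝ :=
  sSup {s : ℝ | s ∈ Set.Ioo (-1 : ℝ) 1 ∧
    p * s / √(1 - s ^ 2) + q * s / √(β ^ 2 - s ^ 2) = h}

/-- The optical length of the Snell path of height `h` with light and dark thickness `p`, `q`. -/
def snellLength (β p q h : ℝ) : ℝ :=
  p / √(1 - snellSine β p q h ^ 2) + β ^ 2 * q / √(β ^ 2 - snellSine β p q h ^ 2)

/-- The dark thickness crossed by the Snell path from `(0, 0)` to `(t + 1, 1)`. -/
def darkThickness (t : ℝ) : ℝ :=
  if Odd ⌊t⌋ then (⌊t + 1⌋ : ℝ) / 2 else t - (⌊t⌋ : ℝ) / 2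

/-- The light thickness crossed by the Snell path from `(0, 0)` to `(t + 1, 1)`. -/
def lightThickness (t : ℝ) : ℝ := t + 1 - darkThickness t

/-- The normalized length `l(t, β)`: the optical length of the Snell path from `(0, 0)` to
`(t + 1, 1)` minus the length `t + √2` of the shortest path avoiding the dark squares. -/
def normalizedLength (t β : ℝ) : ℝ :=
  snellLength β (lightThickness t) (darkThickness t) 1 - t - √2

/-- `δ(k, β) = l(2 k + 2, β) - l(2 k, β)`. -/
def delta (k : ℕ) (β : ℝ) : ℝ :=
  normalizedLength (2 * k + 2) β - normalizedLength (2 * k) β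

/-- The critical value `β^c_k`: the unique `β ∈ (1, √2)` with `δ(k, β) = 0`
(the infimum of a singleton). -/
def criticalBeta (k : ℕ) : ℝ := sInf {β : ℝ | β ∈ Set.Ioo 1 (√2) ∧ delta k β = 0}

end Chessboard

end

/-! The proof is a calibration argument. The definition of the critical index provides some `b < β`
for which crossing a light, a dark and a light strip of unit width, with total rise `1`, costs at
least `2 + √2` when the dark index is `b` (`exists_index_lt`). From this inequality one builds a
function `φ` on the plane (`calibration`) that is `1`-Lipschitz on each closed light square,
`b`-Lipschitz on each closed dark square, and equal to `x + (√2 - 1) y` on the net formed by the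
integer horizontal lines and the light diagonals. In a light square `φ` is, up to constants, the
distance from the lower left vertex below the diagonal and minus the distance to the upper right
vertex above it. In a dark square it is a Lipschitz extension of the boundary values so prescribed
(`exists_isDarkProfile`); the crossing inequality is exactly the Lipschitz condition between the
left and right sides.

The increment of `φ` along a curve is at most its optical length for the index `b`, hence for `β`.
Between the two endpoints `φ` increases by `√2 j + 2 n`, the length of the path that follows the
diagonal and then a horizontal line. Thus `φ` measures the optical length of every arc of a geodesic
(`calibrationAlong_sub_eq_integral`).

Rigidity follows. Since `b < β` strictly, a geodesic cannot move inside a dark square. Inside a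
light triangle it would have to follow a ray through a vertex, which leads into a dark square. So it
stays on the net (`mem_net_of_calibrated`), where the explicit form of `φ` forces `y` and `x - y` to
be nondecreasing (`calibrated_monotone`). The decomposition into segments is then elementary
(`structure_of_monotone`). -/

namespace Chessboard

/-! ### Snell paths and the critical index. -/

lemma div_sqrt_sub_sq_lt {c s t : ℝ} (hc : 1 ≤ c) (hs : -1 < s) (hst : s < t) (ht : t < 1) :
    s / √(c ^ 2 - s ^ 2) < t / √(c ^ 2 - t ^ 2) := by
  have h1 : 0 < √(c ^ 2 - s ^ 2) := Real.sqrt_pos.2 (by nlinarith)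
  have h2 : 0 < √(c ^ 2 - t ^ 2) := Real.sqrt_pos.2 (by nlinarith)
  rw [div_lt_div_iff₀ h1 h2]
  rcases le_or_gt 0 s with h | h
  · have : √(c ^ 2 - t ^ 2) ≤ √(c ^ 2 - s ^ 2) := Real.sqrt_le_sqrt (by nlinarith)
    nlinarith
  · rcases le_or_gt 0 t with h' | h'
    · nlinarith [mul_pos (neg_pos.2 h) h2, mul_nonneg h' h1.le]
    · have : √(c ^ 2 - s ^ 2) ≤ √(c ^ 2 - t ^ 2) := Real.sqrt_le_sqrt (by nlinarith)
      nlinarith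

lemma snellSine_eq {β p q h s : ℝ} (hβ : 1 ≤ β) (hp : 0 < p) (hq : 0 ≤ q)
    (hs : s ∈ Set.Ioo (-1 : ℝ) 1)
    (he : p * s / √(1 - s ^ 2) + q * s / √(β ^ 2 - s ^ 2) = h) : snellSine β p q h = s := by
  have hlt : ∀ u v : ℝ, -1 < u → u < v → v < 1 →
      p * u / √(1 - u ^ 2) + q * u / √(β ^ 2 - u ^ 2) <
        p * v / √(1 - v ^ 2) + q * v / √(β ^ 2 - v ^ 2) := by
    intro u v hu huv hv
    have h1 := div_sqrt_sub_sq_lt le_rfl hu huv hv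
    have h2 := div_sqrt_sub_sq_lt hβ hu huv hv
    rw [one_pow] at h1
    simp only [mul_div_assoc]
    exact add_lt_add_of_lt_of_le (mul_lt_mul_of_pos_left h1 hp)
      (mul_le_mul_of_nonneg_left h2.le hq)
  have : {s : ℝ | s ∈ Set.Ioo (-1 : ℝ) 1 ∧
      p * s / √(1 - s ^ 2) + q * s / √(β ^ 2 - s ^ 2) = h} = {s} := by
    ext t
    simp only [Set.mem_ofPred_eq, Set.mem_singleton_iff]
    constructor
    · rintro ⟨ht, hte⟩
      rcases lt_trichotomy t s with hc | hc | hc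
      · exact absurd (hlt t s ht.1 hc hs.2) (by rw [he, hte]; exact lt_irrefl _)
      · exact hc
      · exact absurd (hlt s t hs.1 hc ht.2) (by rw [he, hte]; exact lt_irrefl _)
    · rintro rfl
      exact ⟨hs, he⟩
  rw [snellSine, this, csSup_singleton]

lemma snellLength_one_zero {β : ℝ} (hβ : 1 ≤ β) : snellLength β 1 0 1 = √2 := by
  have h2 : √(2 : ℝ) ^ 2 = 2 := Real.sq_sqrt (by norm_num)
  have h2' : 1 < √(2 : ℝ) := Real.lt_sqrt_of_sq_lt (by norm_num)
  have hsq : √(1 - (√2 / 2) ^ 2 : ℝ) = √2 / 2 := by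
    rw [show (1 - (√2 / 2) ^ 2 : ℝ) = (√2 / 2) ^ 2 by rw [div_pow, h2]; norm_num]
    exact Real.sqrt_sq (by positivity)
  have hs : snellSine β 1 0 1 = √2 / 2 := by
    refine snellSine_eq hβ one_pos le_rfl ⟨by linarith, by nlinarith⟩ ?_
    rw [hsq]
    field_simp
    simp
  rw [snellLength, hs, hsq, mul_zero, zero_div, add_zero]
  field_simp
  exact h2.symm

lemma delta_zero_eq {β : ℝ} (hβ : 1 ≤ β) : delta 0 β = snellLength β 2 1 1 - 2 - √2 := by
  have hf2 : ⌊(2 : ℝ)⌋ = 2 := by norm_num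
  have hd2 : darkThickness 2 = 1 := by
    rw [darkThickness, hf2, if_neg (by decide)]; norm_num
  have hd0 : darkThickness 0 = 0 := by
    rw [darkThickness, Int.floor_zero, if_neg (by decide)]; norm_num
  simp only [delta, normalizedLength, lightThickness, Nat.cast_zero, mul_zero, zero_add, hd2, hd0]
  rw [show (2 + 1 - 1 : ℝ) = 2 by norm_num, sub_zero, sub_zero, snellLength_one_zero hβ]
  ring

/-- Nonemptiness matters because `criticalBeta` is an infimum. The Snell path to `(3, 1)` is
parametrized by its slope `y` in the light strips; the dark slope is then `1 - 2 y`. Snell's law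
gives `b ^ 2 = s ^ 2 + d ^ 2` with `s = y / √(1 + y ^ 2)` and `d = s / (1 - 2 y)`, and the length is
the explicit function of `y` below. At `y = 1 / 3` the path is straight and `b = 1`; at `y = 4 / 11`
the length exceeds `2 + √2` while `b ^ 2 < 2`. -/
lemma exists_criticalBeta_set :
    ∃ β : ℝ, β ∈ Set.Ioo 1 (√2) ∧ delta 0 β = 0 := by
  have hcont : ContinuousOn (fun y : ℝ => (2 + y + y / (1 - 2 * y)) / √(1 + y ^ 2))
      (Set.Icc (1 / 3) (4 / 11)) := by
    refine ContinuousOn.div ?_ (by fun_prop) ?_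
    · refine ContinuousOn.add (by fun_prop) (ContinuousOn.div (by fun_prop) (by fun_prop) ?_)
      intro x hx
      have := hx.2
      linarith
    · intro x _
      have : 0 < √(1 + x ^ 2) := by positivity
      exact this.ne'
  have h2 : √(2 : ℝ) ^ 2 = 2 := Real.sq_sqrt (by norm_num)
  have h2l : (1.414 : ℝ) < √2 := Real.lt_sqrt_of_sq_lt (by norm_num)
  have h2u : √2 < (1.415 : ℝ) := (Real.sqrt_lt' (by norm_num)).2 (by norm_num)
  have hlow : (2 + (1 / 3 : ℝ) + (1 / 3) / (1 - 2 * (1 / 3))) / √(1 + (1 / 3) ^ 2) < 2 + √2 := by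
    have : (1.05 : ℝ) < √(1 + (1 / 3) ^ 2) := Real.lt_sqrt_of_sq_lt (by norm_num)
    rw [div_lt_iff₀ (by positivity)]
    norm_num at this ⊢
    nlinarith
  have hhigh : 2 + √2 < (2 + (4 / 11 : ℝ) + (4 / 11) / (1 - 2 * (4 / 11))) / √(1 + (4 / 11) ^ 2) := by
    have : √(1 + (4 / 11) ^ 2) < (1.065 : ℝ) := (Real.sqrt_lt' (by norm_num)).2 (by norm_num)
    rw [lt_div_iff₀ (by positivity)]
    norm_num at this ⊢
    nlinarith
  obtain ⟨y, ⟨hy1, hy2⟩, hy⟩ := intermediate_value_Icc (by norm_num) hcont ⟨hlow.le, hhigh.le⟩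
  have hy1' : 1 / 3 < y := by
    refine lt_of_le_of_ne hy1 ?_
    rintro rfl
    exact hlow.ne hy
  simp only at hy
  set r := √(1 + y ^ 2) with hr
  have hr2 : r ^ 2 = 1 + y ^ 2 := Real.sq_sqrt (by positivity)
  have hr0 : 0 < r := by positivity
  have hd : 0 < 1 - 2 * y := by linarith
  set s := y / r with hs
  set d := y / (r * (1 - 2 * y)) with hdd
  have hd0 : 0 < d := by positivity
  set b := √(s ^ 2 + d ^ 2) with hb
  have hb2 : b ^ 2 = s ^ 2 + d ^ 2 := Real.sq_sqrt (by positivity)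
  have hs2 : s ^ 2 = y ^ 2 / (1 + y ^ 2) := by rw [hs, div_pow, hr2]
  have hd2 : d ^ 2 = y ^ 2 / ((1 + y ^ 2) * (1 - 2 * y) ^ 2) := by
    rw [hdd, div_pow, mul_pow, hr2]
  have hb1 : 1 < b := by
    refine Real.lt_sqrt_of_sq_lt ?_
    rw [hs2, hd2]
    have e1 : 1 / 10 < y ^ 2 / (1 + y ^ 2) := by
      rw [div_lt_div_iff₀ (by norm_num) (by positivity)]; nlinarith
    have e2 : 9 / 10 < y ^ 2 / ((1 + y ^ 2) * (1 - 2 * y) ^ 2) := by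
      rw [← div_div, lt_div_iff₀ (by positivity)]
      nlinarith
    linarith
  have hbs : b < √2 := by
    refine Real.sqrt_lt_sqrt (by positivity) ?_
    rw [hs2, hd2]
    have e1 : y ^ 2 / (1 + y ^ 2) ≤ 16 / 137 := by
      rw [div_le_div_iff₀ (by positivity) (by norm_num)]; nlinarith
    have e2 : y ^ 2 / ((1 + y ^ 2) * (1 - 2 * y) ^ 2) ≤ 16 / 137 * (121 / 9) := by
      rw [← div_div, div_le_iff₀ (by positivity)]
      have : (9 / 121 : ℝ) ≤ (1 - 2 * y) ^ 2 := by nlinarith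
      nlinarith
    norm_num at e1 e2 ⊢
    linarith
  have hq1 : √(1 - s ^ 2) = 1 / r := by
    rw [show 1 - s ^ 2 = (1 / r) ^ 2 by rw [hs2, div_pow, hr2]; field_simp; ring]
    exact Real.sqrt_sq (by positivity)
  have hq2 : √(b ^ 2 - s ^ 2) = d := by
    rw [hb2, add_sub_cancel_left]; exact Real.sqrt_sq hd0.le
  have hs0 : 0 < s := by have : 0 < y := by linarith
                         positivity
  have hs1 : s < 1 := by
    have : s ^ 2 < 1 := by
      rw [hs2, div_lt_one (by positivity)]; linarith
    nlinarith
  have hy0 : y ≠ 0 := by linarith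
  have hsn : snellSine b 2 1 1 = s := by
    refine snellSine_eq hb1.le (by norm_num) zero_le_one ⟨by linarith, hs1⟩ ?_
    rw [hq1, hq2, hs, hdd]
    field_simp
    ring
  refine ⟨b, ⟨hb1, hbs⟩, ?_⟩
  rw [delta_zero_eq hb1.le, snellLength, hsn, hq1, hq2, hb2, sub_sub, sub_eq_zero, ← hy, hs, hdd]
  field_simp
  rw [hr2]
  ring

lemma exists_snellSine_two_one {β : ℝ} (hβ : 1 < β) :
    ∃ s ∈ Set.Ioo (-1 : ℝ) 1, 2 * s / √(1 - s ^ 2) + 1 * s / √(β ^ 2 - s ^ 2) = 1 := by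
  have hcont : ContinuousOn (fun s : ℝ => 2 * s / √(1 - s ^ 2) + 1 * s / √(β ^ 2 - s ^ 2))
      (Set.Icc 0 (4 / 5)) := by
    refine ContinuousOn.add (ContinuousOn.div (by fun_prop) (by fun_prop) ?_)
      (ContinuousOn.div (by fun_prop) (by fun_prop) ?_) <;>
    · intro x hx
      have := hx.1
      have := hx.2
      exact (Real.sqrt_pos.2 (by nlinarith)).ne'
  -- At `s = 4 / 5` the light term alone is `8 / 3`, so the value `1` is attained before.
  have h1 : √(1 - (4 / 5) ^ 2 : ℝ) = 3 / 5 := by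
    rw [show (1 - (4 / 5) ^ 2 : ℝ) = (3 / 5) ^ 2 by norm_num]
    exact Real.sqrt_sq (by norm_num)
  have h2 : 0 ≤ 1 * (4 / 5) / √(β ^ 2 - (4 / 5) ^ 2) := by positivity
  obtain ⟨s, hs, he⟩ := intermediate_value_Icc (by norm_num) hcont
    (show (1 : ℝ) ∈ _ from ⟨by simp, by simp only [h1]; linarith⟩)
  exact ⟨s, ⟨by linarith [hs.1], by linarith [hs.2]⟩, he⟩

/-- Cauchy–Schwarz for `(√(c² - s²), s)`, of norm `c`, and `(1, d)`. Here `s` acts as a Lagrange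
multiplier for the rise `d` across a strip of index `c`. -/
lemma mul_add_mul_le_sqrt (c s d : ℝ) (hs : s ^ 2 ≤ c ^ 2) (hc : 0 ≤ c) :
    √(c ^ 2 - s ^ 2) + s * d ≤ c * √(1 + d ^ 2) := by
  have h1 := Real.sq_sqrt (sub_nonneg.2 hs)
  have h2 := Real.sq_sqrt (show 0 ≤ 1 + d ^ 2 by positivity)
  refine le_of_sq_le_sq ?_ (by positivity) 
  rw [mul_pow, h2]
  nlinarith [sq_nonneg (√(c ^ 2 - s ^ 2) * d - s)]

/-- The Snell path minimizes the optical length among the polygonal paths from `(0, 0)` to `(3, 1)`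
through `(1, y)` and `(2, z)`. -/
lemma snellLength_two_one_le {β : ℝ} (hβ : 1 < β) (y z : ℝ) :
    snellLength β 2 1 1 ≤ √(1 + y ^ 2) + β * √(1 + (z - y) ^ 2) + √(1 + (1 - z) ^ 2) := by
  obtain ⟨s, hs, he⟩ := exists_snellSine_two_one hβ
  have hsn : snellSine β 2 1 1 = s := snellSine_eq hβ.le (by norm_num) zero_le_one hs he
  have hs2 : s ^ 2 < 1 := by nlinarith [hs.1, hs.2]
  have i1 := mul_add_mul_le_sqrt 1 s y (by nlinarith) zero_le_one
  have i2 := mul_add_mul_le_sqrt 1 s (1 - z) (by nlinarith) zero_le_one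
  have i3 := mul_add_mul_le_sqrt β s (z - y) (by nlinarith) (by linarith)
  rw [one_pow, one_mul] at i1 i2
  rw [snellLength, hsn]
  have p1 : 0 < √(1 - s ^ 2) := Real.sqrt_pos.2 (by linarith)
  have p2 : 0 < √(β ^ 2 - s ^ 2) := Real.sqrt_pos.2 (by nlinarith)
  have q1 := Real.sq_sqrt (show 0 ≤ 1 - s ^ 2 by linarith)
  have q2 := Real.sq_sqrt (show 0 ≤ β ^ 2 - s ^ 2 by nlinarith)
  have e1 : 2 / √(1 - s ^ 2) = 2 * √(1 - s ^ 2) + s * (2 * s / √(1 - s ^ 2)) := by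
    field_simp; linarith
  have e2 : β ^ 2 * 1 / √(β ^ 2 - s ^ 2) =
      √(β ^ 2 - s ^ 2) + s * (1 * s / √(β ^ 2 - s ^ 2)) := by
    field_simp; linarith
  -- The rises `y`, `z - y`, `1 - z` add up to `1`, so the right-hand side is the sum of the three
  -- lower bounds above.
  have : 2 / √(1 - s ^ 2) + β ^ 2 * 1 / √(β ^ 2 - s ^ 2) =
      2 * √(1 - s ^ 2) + √(β ^ 2 - s ^ 2) + s * 1 := by
    rw [e1, e2]; linear_combination s * he
  rw [this]
  linarith

/-- Any zero `b < β` of `delta 0` will do, so uniqueness of the critical value is not needed. The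
strict gap between `b` and `β` is what later excludes the dark squares. -/
lemma exists_index_lt {β : ℝ} (hβ : criticalBeta 0 < β) :
    ∃ b, b < β ∧ 1 < b ∧ ∀ y z : ℝ,
      2 + √2 ≤ √(1 + y ^ 2) + b * √(1 + (z - y) ^ 2) + √(1 + (1 - z) ^ 2) := by
  obtain ⟨b, hb, hlt⟩ := exists_lt_of_csInf_lt exists_criticalBeta_set hβ
  refine ⟨b, hlt, hb.1.1, fun y z => ?_⟩
  have h1 := snellLength_two_one_le hb.1.1 y z
  have h2 := delta_zero_eq hb.1.1.le
  rw [hb.2] at h2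
  linarith

/-- The points `1 / 3` and `2 / 3` give the straight segment, of cost `(2 + b) √10 / 3`. -/
lemma three_halves_le_sq_of_crossing {b : ℝ} (hb : 1 < b) (h : ∀ y z : ℝ,
      2 + √2 ≤ √(1 + y ^ 2) + b * √(1 + (z - y) ^ 2) + √(1 + (1 - z) ^ 2)) : 3 / 2 ≤ b ^ 2 := by
  have h1 := h (1 / 3) (2 / 3)
  norm_num at h1
  have h2l : (1.414 : ℝ) < √2 := Real.lt_sqrt_of_sq_lt (by norm_num)
  have : √(10 : ℝ) < 3.163 := (Real.sqrt_lt' (by norm_num)).2 (by norm_num)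
  have h3 : √(10 / 9 : ℝ) < 1.0544 := (Real.sqrt_lt' (by norm_num)).2 (by norm_num)
  have : 1.2247 < b := by
    by_contra! hc
    norm_num at h3 hc
    nlinarith
  nlinarith

/-! ### Triangle inequalities in coordinates. -/

lemma sqrt_sq_add_sq_add_le (a b c d : ℝ) :
    √((a + c) ^ 2 + (b + d) ^ 2) ≤ √(a ^ 2 + b ^ 2) + √(c ^ 2 + d ^ 2) := by
  have h1 := Real.sq_sqrt (show 0 ≤ a ^ 2 + b ^ 2 by positivity)
  have h2 := Real.sq_sqrt (show 0 ≤ c ^ 2 + d ^ 2 by positivity)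
  have h3 : a * c + b * d ≤ √(a ^ 2 + b ^ 2) * √(c ^ 2 + d ^ 2) := by
    refine le_of_sq_le_sq ?_ (by positivity)
    rw [mul_pow, h1, h2]
    nlinarith [sq_nonneg (a * d - b * c)]
  exact Real.sqrt_le_iff.2 ⟨by positivity, by nlinarith⟩

lemma sqrt_sub_sqrt_le (a b c d : ℝ) :
    √(a ^ 2 + b ^ 2) - √(c ^ 2 + d ^ 2) ≤ √((a - c) ^ 2 + (b - d) ^ 2) := by
  have := sqrt_sq_add_sq_add_le (a - c) (b - d) c d
  rw [sub_add_cancel, sub_add_cancel] at this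
  linarith

lemma abs_sqrt_sub_sqrt_le (a b c d : ℝ) :
    |√(a ^ 2 + b ^ 2) - √(c ^ 2 + d ^ 2)| ≤ √((a - c) ^ 2 + (b - d) ^ 2) := by
  rw [abs_le]
  have h1 := sqrt_sub_sqrt_le a b c d
  have h2 := sqrt_sub_sqrt_le c d a b
  rw [show (c - a) ^ 2 + (d - b) ^ 2 = (a - c) ^ 2 + (b - d) ^ 2 by ring] at h2
  exact ⟨by linarith, h1⟩

lemma sqrt_sq_add_sq_self {z : ℝ} (hz : 0 ≤ z) : √(z ^ 2 + z ^ 2) = √2 * z := by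
  rw [← two_mul, Real.sqrt_mul (by norm_num), Real.sqrt_sq hz]

/-- If `(a, b)` is at least as far from the origin as `(c, d)` plus their distance, then `(a, b)` is
a multiple `≥ 1` of `(c, d)`. -/
lemma eq_mul_of_dist_add_le {a b c d : ℝ} (hc : 0 < c)
    (h : √((a - c) ^ 2 + (b - d) ^ 2) ≤ √(a ^ 2 + b ^ 2) - √(c ^ 2 + d ^ 2)) :
    ∃ m, 1 ≤ m ∧ a = m * c ∧ b = m * d := by
  have h1 := Real.sq_sqrt (show 0 ≤ a ^ 2 + b ^ 2 by positivity)
  have h2 := Real.sq_sqrt (show 0 ≤ c ^ 2 + d ^ 2 by positivity)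
  have h3 := Real.sq_sqrt (show 0 ≤ (a - c) ^ 2 + (b - d) ^ 2 by positivity)
  have n1 := Real.sqrt_nonneg (a ^ 2 + b ^ 2)
  have n2 := Real.sqrt_nonneg (c ^ 2 + d ^ 2)
  have n3 := Real.sqrt_nonneg ((a - c) ^ 2 + (b - d) ^ 2)
  set A := √(a ^ 2 + b ^ 2)
  set C := √(c ^ 2 + d ^ 2)
  set D := √((a - c) ^ 2 + (b - d) ^ 2)
  have hAC : A * C ≤ a * c + b * d := by nlinarith
  have hpos : 0 ≤ A * C := by positivity
  have hsq : (A * C) ^ 2 ≤ (a * c + b * d) ^ 2 := by gcongr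
  have hdet : (a * d - b * c) ^ 2 ≤ 0 := by
    rw [mul_pow, h1, h2] at hsq
    nlinarith
  have hdet' : a * d - b * c = 0 := by
    have := le_antisymm hdet (sq_nonneg _)
    exact pow_eq_zero_iff (two_ne_zero) |>.1 this
  have hb : b = a / c * d := by field_simp; linarith
  refine ⟨a / c, ?_, by field_simp, hb⟩
  have hCA : C ^ 2 ≤ A * C := by nlinarith
  have : c ^ 2 + d ^ 2 ≤ a / c * (c ^ 2 + d ^ 2) := by
    have e : a / c * (c ^ 2 + d ^ 2) = a * c + b * d := by
      rw [hb]; field_simp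
    rw [e]; linarith
  have hp : 0 < c ^ 2 + d ^ 2 := by positivity
  by_contra! hm
  nlinarith

/-! ### The calibration on one light square. -/

/-- The calibration in the light unit square, with value `0` at the origin. -/
noncomputable def lightProfile (x y : ℝ) : ℝ :=
  if y ≤ x then √(x ^ 2 + y ^ 2) else √2 - √((1 - x) ^ 2 + (1 - y) ^ 2)

lemma lightProfile_of_ge {x y : ℝ} (hx1 : x ≤ 1) (hx0 : 0 ≤ x) (h : x ≤ y) :
    lightProfile x y = √2 - √((1 - x) ^ 2 + (1 - y) ^ 2) := by
  rcases h.eq_or_lt with rfl | h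
  · rw [lightProfile, if_pos le_rfl, sqrt_sq_add_sq_self hx0, sqrt_sq_add_sq_self (by linarith)]
    ring
  · rw [lightProfile, if_neg (not_le.2 h)]

lemma lightProfile_lipschitz {x y z w : ℝ} (hx : x ∈ Set.Icc (0 : ℝ) 1)
    (hz : z ∈ Set.Icc (0 : ℝ) 1) :
    |lightProfile x y - lightProfile z w| ≤ √((x - z) ^ 2 + (y - w) ^ 2) := by
  have hlow : ∀ x y z w : ℝ, y ≤ x → w ≤ z →
      |lightProfile x y - lightProfile z w| ≤ √((x - z) ^ 2 + (y - w) ^ 2) := by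
    intro x y z w h1 h2
    rw [lightProfile, lightProfile, if_pos h1, if_pos h2]
    exact abs_sqrt_sub_sqrt_le _ _ _ _
  have hup : ∀ x y z w : ℝ, x ∈ Set.Icc (0 : ℝ) 1 → z ∈ Set.Icc (0 : ℝ) 1 → x ≤ y → z ≤ w →
      |lightProfile x y - lightProfile z w| ≤ √((x - z) ^ 2 + (y - w) ^ 2) := by
    intro x y z w hx hz h1 h2
    rw [lightProfile_of_ge hx.2 hx.1 h1, lightProfile_of_ge hz.2 hz.1 h2, abs_sub_comm]
    have := abs_sqrt_sub_sqrt_le (1 - x) (1 - y) (1 - z) (1 - w)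
    rw [show (1 - x - (1 - z)) ^ 2 + (1 - y - (1 - w)) ^ 2 = (x - z) ^ 2 + (y - w) ^ 2 by ring] at this
    convert this using 2
    ring
  have hmix : ∀ x y z w : ℝ, x ∈ Set.Icc (0 : ℝ) 1 → z ∈ Set.Icc (0 : ℝ) 1 → y ≤ x → z < w →
      |lightProfile x y - lightProfile z w| ≤ √((x - z) ^ 2 + (y - w) ^ 2) := by
    intro x y z w hx hz h1 h2
    have hpos : 0 < (x - y) + (w - z) := by linarith
    obtain ⟨t, ht⟩ : ∃ t, t * ((x - y) + (w - z)) = x - y :=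
      ⟨(x - y) / ((x - y) + (w - z)), by field_simp⟩
    have ht0 : 0 ≤ t := by by_contra! hc; nlinarith
    have ht1 : t ≤ 1 := by by_contra! hc; nlinarith
    -- `(v, v)` is the point where the segment between the two given points meets the diagonal; the
    -- two branches agree there, so the one-sided estimates add up.
    set v := x + t * (z - x) with hv
    have hv' : v = y + t * (w - y) := by linarith
    have hvm : v ∈ Set.Icc (0 : ℝ) 1 := by
      constructor
      · nlinarith [hx.1, hz.1]
      · nlinarith [hx.2, hz.2]
    have i1 := hlow x y v v h1 le_rfl
    have i2 := hup v v z w hvm hz le_rfl h2.le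
    rw [show (x - v) ^ 2 + (y - v) ^ 2 = t ^ 2 * ((x - z) ^ 2 + (y - w) ^ 2) by
      nth_rewrite 1 [hv]; rw [hv']; ring, Real.sqrt_mul (sq_nonneg _), Real.sqrt_sq ht0] at i1
    rw [show (v - z) ^ 2 + (v - w) ^ 2 = (1 - t) ^ 2 * ((x - z) ^ 2 + (y - w) ^ 2) by
      nth_rewrite 1 [hv]; rw [hv']; ring, Real.sqrt_mul (sq_nonneg _),
      Real.sqrt_sq (by linarith)] at i2
    calc _ ≤ _ := abs_sub_le _ (lightProfile v v) _
      _ ≤ _ := by linarith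
  rcases le_or_gt y x with h1 | h1 <;> rcases le_or_gt w z with h2 | h2
  · exact hlow _ _ _ _ h1 h2
  · exact hmix _ _ _ _ hx hz h1 h2
  · rw [abs_sub_comm, show (x - z) ^ 2 + (y - w) ^ 2 = (z - x) ^ 2 + (w - y) ^ 2 by ring]
    exact hmix _ _ _ _ hz hx h2 h1
  · exact hup _ _ _ _ hx hz h1.le h2.le

/-! ### The calibration on one dark square. -/

/-- `δ` is a `b`-Lipschitz function with the boundary values, on the dark unit square, that match
those of `lightProfile` on the neighbouring light squares. -/
structure IsDarkProfile (b : ℝ) (δ : ℝ → ℝ → ℝ) : Prop where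
  lipschitz : ∀ x y z w, |δ x y - δ z w| ≤ b * √((x - z) ^ 2 + (y - w) ^ 2)
  left : ∀ y ∈ Set.Icc (0 : ℝ) 1, δ 0 y = √(1 + y ^ 2) - 1
  right : ∀ y ∈ Set.Icc (0 : ℝ) 1, δ 1 y = 1 + √2 - √(1 + (1 - y) ^ 2)
  bottom : ∀ x ∈ Set.Icc (0 : ℝ) 1, δ x 0 = x
  top : ∀ x ∈ Set.Icc (0 : ℝ) 1, δ x 1 = x + √2 - 1

/-- The derivative of `√(1 + t ^ 2)` lies between `0` and `√2 / 2` on `[0, 1]`. -/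
lemma sqrt_one_add_sq_sub {y z : ℝ} (hz : 0 ≤ z) (hzy : z ≤ y) (hy : y ≤ 1) :
    0 ≤ √(1 + y ^ 2) - √(1 + z ^ 2) ∧
      √(1 + y ^ 2) - √(1 + z ^ 2) ≤ √2 / 2 * (y - z) := by
  have h1 := Real.sq_sqrt (show 0 ≤ 1 + y ^ 2 by positivity)
  have h2 := Real.sq_sqrt (show 0 ≤ 1 + z ^ 2 by positivity)
  have h3 := Real.sq_sqrt (show (0 : ℝ) ≤ 2 by norm_num)
  have p1 : 0 < √(1 + y ^ 2) := by positivity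
  have p2 : 0 < √(1 + z ^ 2) := by positivity
  have p3 : 0 < √(2 : ℝ) := by positivity
  have k : ∀ t : ℝ, 0 ≤ t → t ≤ 1 → t ≤ √2 / 2 * √(1 + t ^ 2) := by
    intro t h0 h1
    refine le_of_sq_le_sq ?_ (by positivity)
    rw [mul_pow, div_pow, h3, Real.sq_sqrt (by positivity)]
    nlinarith
  have k1 := k y (hz.trans hzy) hy
  have k2 := k z hz (hzy.trans hy)
  refine ⟨sub_nonneg.2 (Real.sqrt_le_sqrt (by nlinarith)), ?_⟩
  by_contra! hc
  have := mul_lt_mul_of_pos_right hc (add_pos p1 p2)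
  nlinarith [mul_le_mul_of_nonneg_left (add_le_add k1 k2) (sub_nonneg.2 hzy)]

lemma darkProfile_boundary {b : ℝ} (hb : 1 < b)
    (h : ∀ y z : ℝ, 2 + √2 ≤ √(1 + y ^ 2) + b * √(1 + (z - y) ^ 2) + √(1 + (1 - z) ^ 2))
    {x y z w v v' : ℝ} (hx : x ∈ Set.Icc (0 : ℝ) 1) (hy : y ∈ Set.Icc (0 : ℝ) 1)
    (hz : z ∈ Set.Icc (0 : ℝ) 1) (hw : w ∈ Set.Icc (0 : ℝ) 1)
    (hv : (x = 0 ∧ v = √(1 + y ^ 2) - 1) ∨ (x = 1 ∧ v = 1 + √2 - √(1 + (1 - y) ^ 2)) ∨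
      (y = 0 ∧ v = x) ∨ (y = 1 ∧ v = x + √2 - 1))
    (hv' : (z = 0 ∧ v' = √(1 + w ^ 2) - 1) ∨ (z = 1 ∧ v' = 1 + √2 - √(1 + (1 - w) ^ 2)) ∨
      (w = 0 ∧ v' = z) ∨ (w = 1 ∧ v' = z + √2 - 1)) :
    v - v' ≤ b * √((x - z) ^ 2 + (y - w) ^ 2) := by
  -- The increment from the left side to the right side is the only tight case: it is the crossing
  -- inequality itself.
  by_cases hlr : x = 1 ∧ v = 1 + √2 - √(1 + (1 - y) ^ 2) ∧ z = 0 ∧ v' = √(1 + w ^ 2) - 1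
  · obtain ⟨rfl, rfl, rfl, rfl⟩ := hlr
    have := h w y
    norm_num at this ⊢
    linarith
  have h3 := Real.sq_sqrt (show (0 : ℝ) ≤ 2 by norm_num)
  have p3 : 1 < √(2 : ℝ) := Real.lt_sqrt_of_sq_lt (by norm_num)
  have p4 : √(2 : ℝ) < 3 / 2 := (Real.sqrt_lt' (by norm_num)).2 (by norm_num)
  -- All other pairs of sides satisfy a cruder bound, and `1 ^ 2 + (√2 / 2) ^ 2 = 3 / 2 ≤ b ^ 2`
  -- concludes by Cauchy–Schwarz.
  have hkey : v - v' ≤ |x - z| + √2 / 2 * |y - w| := by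
    have f0 : √(1 + 0 ^ 2 : ℝ) = 1 := by norm_num
    have f1 : √(1 + 1 ^ 2 : ℝ) = √2 := by norm_num
    have k1 := sqrt_one_add_sq_sub le_rfl hy.1 hy.2
    have k2 := sqrt_one_add_sq_sub hy.1 hy.2 le_rfl
    have k3 := sqrt_one_add_sq_sub le_rfl hw.1 hw.2
    have k4 := sqrt_one_add_sq_sub hw.1 hw.2 le_rfl
    have k5 := sqrt_one_add_sq_sub (y := 1 - y) le_rfl (by linarith [hy.2]) (by linarith [hy.1])
    have k6 := sqrt_one_add_sq_sub (z := 1 - y) (by linarith [hy.2]) (by linarith [hy.1]) le_rfl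
    have k7 := sqrt_one_add_sq_sub (y := 1 - w) le_rfl (by linarith [hw.2]) (by linarith [hw.1])
    have k8 := sqrt_one_add_sq_sub (z := 1 - w) (by linarith [hw.2]) (by linarith [hw.1]) le_rfl
    rw [f0] at k1 k3 k5 k7
    rw [f1] at k2 k4 k6 k8
    have k9 : √(1 + y ^ 2) - √(1 + w ^ 2) ≤ √2 / 2 * |y - w| := by
      rcases le_total w y with hc | hc
      · rw [abs_of_nonneg (by linarith)]
        exact (sqrt_one_add_sq_sub hw.1 hc hy.2).2
      · have := (sqrt_one_add_sq_sub hy.1 hc hw.2).1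
        have : 0 ≤ √2 / 2 * |y - w| := by positivity
        linarith
    have k10 : √(1 + (1 - w) ^ 2) - √(1 + (1 - y) ^ 2) ≤ √2 / 2 * |y - w| := by
      rcases le_total w y with hc | hc
      · rw [abs_of_nonneg (by linarith)]
        have := (sqrt_one_add_sq_sub (y := 1 - w) (z := 1 - y) (by linarith [hy.2]) (by linarith)
          (by linarith [hw.1])).2
        linarith
      · have := (sqrt_one_add_sq_sub (y := 1 - y) (z := 1 - w) (by linarith [hw.2]) (by linarith)
          (by linarith [hy.1])).1
        have : 0 ≤ √2 / 2 * |y - w| := by positivity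
        linarith
    have a1 := le_abs_self (x - z)
    have a2 := neg_abs_le (x - z)
    have a3 : √2 / 2 * (y - w) ≤ √2 / 2 * |y - w| := by gcongr; exact le_abs_self _
    have a4 : √2 / 2 * (w - y) ≤ √2 / 2 * |y - w| := by
      gcongr; rw [abs_sub_comm]; exact le_abs_self _
    have hx1 := hx.1
    have hx2 := hx.2
    have hz1 := hz.1
    have hz2 := hz.2
    have hn : 0 ≤ √2 / 2 * |y - w| := by positivity
    have hn' : 0 ≤ |x - z| := abs_nonneg _
    rcases hv with ⟨e, e'⟩ | ⟨e, e'⟩ | ⟨e, e'⟩ | ⟨e, e'⟩ <;>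
      rcases hv' with ⟨e1, e1'⟩ | ⟨e1, e1'⟩ | ⟨e1, e1'⟩ | ⟨e1, e1'⟩ <;>
      first
        | linarith
        | (simp only [e, e1] at a1 a2 a3 a4 hn hn' k1 k2 k3 k4 k5 k6 k7 k8 k9 k10 e' e1' ⊢
           linarith)
        | exact (hlr ⟨e, e', e1, e1'⟩).elim
  refine hkey.trans ?_
  have hb2 := three_halves_le_sq_of_crossing hb h
  refine le_of_sq_le_sq ?_ (by positivity)
  rw [mul_pow, Real.sq_sqrt (by positivity), ← sq_abs (x - z), ← sq_abs (y - w)]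
  have : (|x - z| + √2 / 2 * |y - w|) ^ 2 ≤ 3 / 2 * (|x - z| ^ 2 + |y - w| ^ 2) := by
    nlinarith [sq_nonneg (√2 / 2 * |x - z| - |y - w|)]
  nlinarith [sq_nonneg |x - z|, sq_nonneg |y - w|]

lemma exists_isDarkProfile {b : ℝ} (hb : 1 < b)
    (h : ∀ y z : ℝ, 2 + √2 ≤ √(1 + y ^ 2) + b * √(1 + (z - y) ^ 2) + √(1 + (1 - z) ^ 2)) :
    ∃ δ, IsDarkProfile b δ := by
  -- Interpolating the values on the left and right sides linearly in `x` reproduces the prescribed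
  -- values on the bottom and top. Only the restriction of `g` to the boundary of the square is
  -- used; it is then extended with the same Lipschitz constant.
  let g : Plane → ℝ := fun P => (1 - P 0) * (√(1 + P 1 ^ 2) - 1) +
    P 0 * (1 + √2 - √(1 + (1 - P 1) ^ 2))
  let s : Set Plane := {P | P 0 ∈ Set.Icc (0 : ℝ) 1 ∧ P 1 ∈ Set.Icc (0 : ℝ) 1 ∧
    (P 0 = 0 ∨ P 0 = 1 ∨ P 1 = 0 ∨ P 1 = 1)}
  have f1 : √(1 + 1 : ℝ) = √2 := by norm_num
  have hval : ∀ P ∈ s, (P 0 = 0 ∧ g P = √(1 + P 1 ^ 2) - 1) ∨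
      (P 0 = 1 ∧ g P = 1 + √2 - √(1 + (1 - P 1) ^ 2)) ∨
      (P 1 = 0 ∧ g P = P 0) ∨ (P 1 = 1 ∧ g P = P 0 + √2 - 1) := by
    rintro P ⟨_, _, hP⟩
    rcases hP with hP | hP | hP | hP
    · exact Or.inl ⟨hP, by simp [g, hP]⟩
    · exact Or.inr (Or.inl ⟨hP, by simp [g, hP]⟩)
    · exact Or.inr (Or.inr (Or.inl ⟨hP, by simp [g, hP, f1]⟩))
    · exact Or.inr (Or.inr (Or.inr ⟨hP, by simp [g, hP, f1]; ring⟩))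
  have hlip : LipschitzOnWith (Real.toNNReal b) g s := by
    refine LipschitzOnWith.of_dist_le_mul fun P hP Q hQ => ?_
    rw [Real.coe_toNNReal b (by linarith), EuclideanSpace.dist_eq, Fin.sum_univ_two,
      Real.dist_eq, Real.dist_eq, Real.dist_eq, sq_abs, sq_abs, abs_le]
    have h1 := darkProfile_boundary hb h hP.1 hP.2.1 hQ.1 hQ.2.1 (hval P hP) (hval Q hQ)
    have h2 := darkProfile_boundary hb h hQ.1 hQ.2.1 hP.1 hP.2.1 (hval Q hQ) (hval P hP)
    rw [show (Q 0 - P 0) ^ 2 + (Q 1 - P 1) ^ 2 = (P 0 - Q 0) ^ 2 + (P 1 - Q 1) ^ 2 by ring] at h2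
    exact ⟨by linarith, h1⟩
  obtain ⟨f, hf, hfg⟩ := hlip.extend_real
  have h0 : (0 : ℝ) ∈ Set.Icc (0 : ℝ) 1 := by simp
  have h1 : (1 : ℝ) ∈ Set.Icc (0 : ℝ) 1 := by simp
  refine ⟨fun x y => f !₂[x, y], ?_, ?_, ?_, ?_, ?_⟩
  · intro x y z w
    have := hf.dist_le_mul !₂[x, y] !₂[z, w]
    rw [Real.coe_toNNReal b (by linarith), EuclideanSpace.dist_eq, Fin.sum_univ_two,
      Real.dist_eq, Real.dist_eq, Real.dist_eq, sq_abs, sq_abs] at this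
    simpa using this
  · intro y hy
    rw [← hfg ⟨by simp, by simpa using hy, by simp⟩]
    simp [g]
  · intro y hy
    rw [← hfg ⟨by simp, by simpa using hy, by simp⟩]
    simp [g]
  · intro x hx
    rw [← hfg ⟨by simpa using hx, by simp, by simp⟩]
    simp [g, f1]
  · intro x hx
    rw [← hfg ⟨by simpa using hx, by simp, by simp⟩]
    simp [g, f1]
    ring

/-! ### Gluing the calibration over the chessboard. -/

open Classical in
/-- The calibration on the closed unit square with lower left vertex `(i, h)`. -/
noncomputable def cellCalibration (δ : ℝ → ℝ → ℝ) (i h : ℤ) (x y : ℝ) : ℝ :=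
  i + (√2 - 1) * h + if Even (i + h) then lightProfile (x - i) (y - h) else δ (x - i) (y - h)

/-- The calibration: a function whose variation along a curve bounds its optical length from
below. -/
noncomputable def calibration (δ : ℝ → ℝ → ℝ) (x y : ℝ) : ℝ :=
  cellCalibration δ ⌊x⌋ ⌊y⌋ x y

lemma cellCalibration_of_even {δ : ℝ → ℝ → ℝ} {i h : ℤ} (hih : Even (i + h)) (x y : ℝ) :
    cellCalibration δ i h x y = i + (√2 - 1) * h + lightProfile (x - i) (y - h) := by
  rw [cellCalibration, if_pos hih]

lemma cellCalibration_of_odd {δ : ℝ → ℝ → ℝ} {i h : ℤ} (hih : Odd (i + h)) (x y : ℝ) :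
    cellCalibration δ i h x y = i + (√2 - 1) * h + δ (x - i) (y - h) := by
  rw [cellCalibration, if_neg (Int.not_even_iff_odd.2 hih)]

section

variable {b : ℝ} {δ : ℝ → ℝ → ℝ}

lemma cellCalibration_right (hδ : IsDarkProfile b δ) (i h : ℤ) {y : ℝ}
    (hy : y ∈ Set.Icc (h : ℝ) (h + 1)) :
    cellCalibration δ i h (i + 1) y = cellCalibration δ (i + 1) h (i + 1) y := by
  have hy' : y - h ∈ Set.Icc (0 : ℝ) 1 := ⟨by linarith [hy.1], by linarith [hy.2]⟩
  rcases Int.even_or_odd (i + h) with hp | hp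
  · have hp' : Odd (i + 1 + h) := by rw [add_right_comm]; exact hp.add_one
    rw [cellCalibration_of_even hp, cellCalibration_of_odd hp']
    push_cast
    rw [add_sub_cancel_left, sub_self, hδ.left _ hy', lightProfile, if_pos hy'.2, one_pow]
    ring
  · have hp' : Even (i + 1 + h) := by rw [add_right_comm]; exact hp.add_one
    rw [cellCalibration_of_odd hp, cellCalibration_of_even hp']
    push_cast
    rw [add_sub_cancel_left, sub_self, hδ.right _ hy', lightProfile_of_ge zero_le_one le_rfl hy'.1,
      sub_zero, one_pow]
    ring

lemma cellCalibration_top (hδ : IsDarkProfile b δ) (i h : ℤ) {x : ℝ}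
    (hx : x ∈ Set.Icc (i : ℝ) (i + 1)) :
    cellCalibration δ i h x (h + 1) = cellCalibration δ i (h + 1) x (h + 1) := by
  have hx' : x - i ∈ Set.Icc (0 : ℝ) 1 := ⟨by linarith [hx.1], by linarith [hx.2]⟩
  rcases Int.even_or_odd (i + h) with hp | hp
  · have hp' : Odd (i + (h + 1)) := by rw [← add_assoc]; exact hp.add_one
    rw [cellCalibration_of_even hp, cellCalibration_of_odd hp']
    push_cast
    rw [add_sub_cancel_left, sub_self, hδ.bottom _ hx', lightProfile_of_ge hx'.2 hx'.1 hx'.2,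
      sub_self, zero_pow two_ne_zero, add_zero, Real.sqrt_sq (by linarith [hx'.2])]
    ring
  · have hp' : Even (i + (h + 1)) := by rw [← add_assoc]; exact hp.add_one
    rw [cellCalibration_of_odd hp, cellCalibration_of_even hp']
    push_cast
    rw [add_sub_cancel_left, sub_self, hδ.top _ hx', lightProfile, if_pos hx'.1,
      zero_pow two_ne_zero, add_zero, Real.sqrt_sq hx'.1]
    ring

lemma floor_eq_or_eq_add_one {i : ℤ} {x : ℝ} (hx : x ∈ Set.Icc (i : ℝ) (i + 1)) :
    ⌊x⌋ = i ∨ x = i + 1 ∧ ⌊x⌋ = i + 1 := by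
  rcases hx.2.lt_or_eq with h | h
  · exact Or.inl (Int.floor_eq_iff.2 ⟨hx.1, h⟩)
  · refine Or.inr ⟨h, ?_⟩
    rw [h, Int.floor_add_one, Int.floor_intCast]

/-- Neighbouring cells agree on common sides, so the choice of cell made by the floor function is
immaterial. -/
lemma calibration_eq_cell (hδ : IsDarkProfile b δ) (i h : ℤ) {x y : ℝ}
    (hx : x ∈ Set.Icc (i : ℝ) (i + 1)) (hy : y ∈ Set.Icc (h : ℝ) (h + 1)) :
    calibration δ x y = cellCalibration δ i h x y := by
  have hxm : ∀ k : ℤ, (k : ℝ) + 1 ∈ Set.Icc (k : ℝ) (k + 1) := fun k => ⟨by linarith, le_rfl⟩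
  rw [calibration]
  rcases floor_eq_or_eq_add_one hx with ex | ⟨ex, ex'⟩ <;>
    rcases floor_eq_or_eq_add_one hy with ey | ⟨ey, ey'⟩
  · rw [ex, ey]
  · rw [ex, ey', ey, cellCalibration_top hδ i h hx]
  · rw [ex', ey, ex, cellCalibration_right hδ i h hy]
  · rw [ex', ey', ex, ey, cellCalibration_right hδ i h (hxm h), cellCalibration_top hδ (i + 1) h]
    push_cast
    exact ⟨le_rfl, by linarith⟩

lemma calibration_light_lipschitz (hδ : IsDarkProfile b δ) {i h : ℤ} (hih : Even (i + h))
    {x y z w : ℝ} (hx : x ∈ Set.Icc (i : ℝ) (i + 1)) (hy : y ∈ Set.Icc (h : ℝ) (h + 1))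
    (hz : z ∈ Set.Icc (i : ℝ) (i + 1)) (hw : w ∈ Set.Icc (h : ℝ) (h + 1)) :
    |calibration δ x y - calibration δ z w| ≤ √((x - z) ^ 2 + (y - w) ^ 2) := by
  rw [calibration_eq_cell hδ i h hx hy, calibration_eq_cell hδ i h hz hw,
    cellCalibration_of_even hih, cellCalibration_of_even hih, add_sub_add_left_eq_sub]
  have := lightProfile_lipschitz (x := x - i) (y := y - h) (z := z - i) (w := w - h)
    ⟨by linarith [hx.1], by linarith [hx.2]⟩ ⟨by linarith [hz.1], by linarith [hz.2]⟩
  simpa only [sub_sub_sub_cancel_right] using this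

lemma calibration_dark_lipschitz (hδ : IsDarkProfile b δ) {i h : ℤ} (hih : Odd (i + h))
    {x y z w : ℝ} (hx : x ∈ Set.Icc (i : ℝ) (i + 1)) (hy : y ∈ Set.Icc (h : ℝ) (h + 1))
    (hz : z ∈ Set.Icc (i : ℝ) (i + 1)) (hw : w ∈ Set.Icc (h : ℝ) (h + 1)) :
    |calibration δ x y - calibration δ z w| ≤ b * √((x - z) ^ 2 + (y - w) ^ 2) := by
  rw [calibration_eq_cell hδ i h hx hy, calibration_eq_cell hδ i h hz hw,
    cellCalibration_of_odd hih, cellCalibration_of_odd hih, add_sub_add_left_eq_sub]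
  have := hδ.lipschitz (x - i) (y - h) (z - i) (w - h)
  simpa only [sub_sub_sub_cancel_right] using this

lemma calibration_cell_lipschitz (hb : 1 < b) (hδ : IsDarkProfile b δ) (i h : ℤ)
    {x y z w : ℝ} (hx : x ∈ Set.Icc (i : ℝ) (i + 1)) (hy : y ∈ Set.Icc (h : ℝ) (h + 1))
    (hz : z ∈ Set.Icc (i : ℝ) (i + 1)) (hw : w ∈ Set.Icc (h : ℝ) (h + 1)) :
    |calibration δ x y - calibration δ z w| ≤ b * √((x - z) ^ 2 + (y - w) ^ 2) := by
  rcases Int.even_or_odd (i + h) with hp | hp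
  · exact (calibration_light_lipschitz hδ hp hx hy hz hw).trans
      (le_mul_of_one_le_left (Real.sqrt_nonneg _) hb.le)
  · exact calibration_dark_lipschitz hδ hp hx hy hz hw

/-- A function that is `C`-Lipschitz between consecutive integers is `C`-Lipschitz. -/
lemma abs_sub_le_of_unit_intervals {f : ℝ → ℝ} {C : ℝ}
    (hf : ∀ m : ℤ, ∀ x ∈ Set.Icc (m : ℝ) (m + 1), ∀ y ∈ Set.Icc (m : ℝ) (m + 1),
      |f x - f y| ≤ C * |x - y|) (x y : ℝ) : |f x - f y| ≤ C * |x - y| := by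
  have hint : ∀ (m : ℤ) (k : ℕ), |f m - f (m + k)| ≤ C * k := by
    intro m k
    induction k with
    | zero => simp
    | succ k ih =>
      have h1 := hf (m + k) ((m + k : ℤ) : ℝ) ⟨le_rfl, by linarith⟩ ((m + k : ℤ) + 1 : ℝ)
        ⟨by linarith, le_rfl⟩
      push_cast at h1 ⊢
      rw [show (m : ℝ) + k - (m + k + 1) = -1 by ring, abs_neg, abs_one, add_assoc] at h1
      have := abs_sub_le (f m) (f (m + k)) (f (m + (k + 1)))
      linarith
  wlog hxy : x ≤ y generalizing x y
  · rw [abs_sub_comm, abs_sub_comm x y]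
    exact this y x (le_of_not_ge hxy)
  rw [abs_sub_comm x y, abs_of_nonneg (sub_nonneg.2 hxy)]
  rcases le_or_gt y (⌊x⌋ + 1) with h | h
  · have := hf ⌊x⌋ x ⟨Int.floor_le x, (Int.lt_floor_add_one x).le⟩ y
      ⟨(Int.floor_le x).trans hxy, h⟩
    rwa [abs_sub_comm x y, abs_of_nonneg (sub_nonneg.2 hxy)] at this
  · have hfl : ⌊x⌋ + 1 ≤ ⌊y⌋ := Int.le_floor.2 (by push_cast; exact h.le)
    obtain ⟨k, hk⟩ := Int.le.dest hfl
    have h1 := hf ⌊x⌋ x ⟨Int.floor_le x, (Int.lt_floor_add_one x).le⟩ (⌊x⌋ + 1)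
      ⟨by linarith, le_rfl⟩
    have h2 := hint (⌊x⌋ + 1) k
    have h3 := hf ⌊y⌋ ⌊y⌋ ⟨le_rfl, by linarith⟩ y ⟨Int.floor_le y, (Int.lt_floor_add_one y).le⟩
    rw [abs_sub_comm x (⌊x⌋ + 1),
      abs_of_nonneg (show 0 ≤ ⌊x⌋ + 1 - x by linarith [Int.lt_floor_add_one x])] at h1
    rw [abs_sub_comm (⌊y⌋ : ℝ) y,
      abs_of_nonneg (show 0 ≤ y - ⌊y⌋ by linarith [Int.floor_le y])] at h3
    have hk' : (⌊y⌋ : ℝ) = ⌊x⌋ + 1 + k := by rw [← hk]; push_cast; ring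
    push_cast at h2
    rw [← hk'] at h2
    have e : C * (y - x) = C * (⌊x⌋ + 1 - x) + C * k + C * (y - ⌊y⌋) := by rw [hk']; ring
    rw [e]
    have := abs_sub_le (f x) (f (⌊x⌋ + 1)) (f ⌊y⌋)
    have := abs_sub_le (f x) (f ⌊y⌋) (f y)
    linarith

lemma mem_Icc_floor (x : ℝ) : x ∈ Set.Icc (⌊x⌋ : ℝ) (⌊x⌋ + 1) :=
  ⟨Int.floor_le x, (Int.lt_floor_add_one x).le⟩

/-- A crude global bound, obtained by moving first horizontally and then vertically; it serves to
transfer absolute continuity from a curve to `φ` along it. -/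
lemma calibration_lipschitz (hb : 1 < b) (hδ : IsDarkProfile b δ) (x y z w : ℝ) :
    |calibration δ x y - calibration δ z w| ≤ b * |x - z| + b * |y - w| := by
  have h1 : |calibration δ x y - calibration δ z y| ≤ b * |x - z| := by
    refine abs_sub_le_of_unit_intervals (f := fun x => calibration δ x y) (fun m x hx z hz => ?_) x z
    have := calibration_cell_lipschitz hb hδ m ⌊y⌋ hx (mem_Icc_floor y) hz (mem_Icc_floor y)
    rwa [sub_self, zero_pow two_ne_zero, add_zero, Real.sqrt_sq_eq_abs] at this
  have h2 : |calibration δ z y - calibration δ z w| ≤ b * |y - w| := by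
    refine abs_sub_le_of_unit_intervals (f := fun y => calibration δ z y) (fun m x hx w hw => ?_) y w
    have := calibration_cell_lipschitz hb hδ ⌊z⌋ m (mem_Icc_floor z) hx (mem_Icc_floor z) hw
    rwa [sub_self, zero_pow two_ne_zero, zero_add, Real.sqrt_sq_eq_abs] at this
  have := abs_sub_le (calibration δ x y) (calibration δ z y) (calibration δ z w)
  linarith

/-- The constant is `1` and not `b` because every vertical side belongs to a light square. This
matches the index `1` on the sides. -/
lemma calibration_vertical_lipschitz (hδ : IsDarkProfile b δ) (i : ℤ) (y w : ℝ) :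
    |calibration δ i y - calibration δ i w| ≤ |y - w| := by
  rw [← one_mul |y - w|]
  refine abs_sub_le_of_unit_intervals (f := fun y => calibration δ i y) (fun m y hy w hw => ?_) y w
  rw [one_mul]
  rcases Int.even_or_odd (i + m) with hp | hp
  · have hi : (i : ℝ) ∈ Set.Icc (i : ℝ) (i + 1) := ⟨le_rfl, by linarith⟩
    have := calibration_light_lipschitz hδ hp hi hy hi hw
    rwa [sub_self, zero_pow two_ne_zero, zero_add, Real.sqrt_sq_eq_abs] at this
  · have hi : (i : ℝ) ∈ Set.Icc ((i - 1 : ℤ) : ℝ) ((i - 1 : ℤ) + 1) := by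
      push_cast; constructor <;> linarith
    have hp' : Even (i - 1 + m) := by
      rw [sub_add_eq_add_sub]; exact hp.sub_odd odd_one
    have := calibration_light_lipschitz hδ hp' hi hy hi hw
    rwa [sub_self, zero_pow two_ne_zero, zero_add, Real.sqrt_sq_eq_abs] at this

lemma calibration_horizontal (hδ : IsDarkProfile b δ) (x : ℝ) (h : ℤ) :
    calibration δ x h = x + (√2 - 1) * h := by
  have hx := mem_Icc_floor x
  have hx' : x - ⌊x⌋ ∈ Set.Icc (0 : ℝ) 1 := ⟨by linarith [hx.1], by linarith [hx.2]⟩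
  rw [calibration_eq_cell hδ ⌊x⌋ h hx ⟨le_rfl, by linarith⟩]
  rcases Int.even_or_odd (⌊x⌋ + h) with hp | hp
  · rw [cellCalibration_of_even hp, sub_self, lightProfile, if_pos hx'.1, zero_pow two_ne_zero,
      add_zero, Real.sqrt_sq hx'.1]
    ring
  · rw [cellCalibration_of_odd hp, sub_self, hδ.bottom _ hx']
    ring

lemma calibration_lower (hδ : IsDarkProfile b δ) {i h : ℤ} (hih : Even (i + h)) {x y : ℝ}
    (hx : x ≤ i + 1) (hy : h ≤ y) (hxy : y - h ≤ x - i) :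
    calibration δ x y = i + (√2 - 1) * h + √((x - i) ^ 2 + (y - h) ^ 2) := by
  rw [calibration_eq_cell hδ i h ⟨by linarith, hx⟩ ⟨hy, by linarith⟩, cellCalibration_of_even hih,
    lightProfile, if_pos hxy]

lemma calibration_upper (hδ : IsDarkProfile b δ) {i h : ℤ} (hih : Even (i + h)) {x y : ℝ}
    (hx : i ≤ x) (hy : y ≤ h + 1) (hxy : x - i ≤ y - h) :
    calibration δ x y =
      i + (√2 - 1) * h + √2 - √((i + 1 - x) ^ 2 + (h + 1 - y) ^ 2) := by
  rw [calibration_eq_cell hδ i h ⟨hx, by linarith⟩ ⟨by linarith, hy⟩, cellCalibration_of_even hih,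
    lightProfile_of_ge (by linarith) (by linarith) hxy]
  ring_nf

/-- Together with `calibration_horizontal`, this gives one linear expression for `φ` on the whole
net. -/
lemma calibration_diagonal (hδ : IsDarkProfile b δ) {x y : ℝ} {k : ℤ} (hxy : y = x - 2 * k) :
    calibration δ x y = x + (√2 - 1) * y := by
  have hfl : ⌊y⌋ = ⌊x⌋ - 2 * k := by
    rw [hxy, show x - 2 * (k : ℝ) = x - ((2 * k : ℤ) : ℝ) by push_cast; ring, Int.floor_sub_intCast]
  have hp : Even (⌊x⌋ + ⌊y⌋) := ⟨⌊x⌋ - k, by rw [hfl]; ring⟩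
  have e : y - ⌊y⌋ = x - ⌊x⌋ := by rw [hfl, hxy]; push_cast; ring
  have hx := Int.floor_le x
  rw [calibration_lower hδ hp (Int.lt_floor_add_one x).le (Int.floor_le y) e.le, e,
    sqrt_sq_add_sq_self (by linarith)]
  have e' : (⌊y⌋ : ℝ) = y - (x - ⌊x⌋) := by linarith
  rw [e']
  ring

end

open MeasureTheory Filter Topology

/-! ### Absolutely continuous curves and the optical integrand. -/

section

lemma absolutelyContinuousOnInterval_of_dist_le {X Y : Type*} [PseudoMetricSpace X]
    [PseudoMetricSpace Y] {u : ℝ → X} {f : ℝ → Y} {C a b : ℝ}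
    (hu : AbsolutelyContinuousOnInterval u a b)
    (h : ∀ s t, dist (f s) (f t) ≤ C * dist (u s) (u t)) :
    AbsolutelyContinuousOnInterval f a b := by
  have h0 := Tendsto.const_mul C hu
  rw [mul_zero] at h0
  refine squeeze_zero (fun E => Finset.sum_nonneg fun i _ => dist_nonneg) (fun E => ?_) h0
  rw [Finset.mul_sum]
  exact Finset.sum_le_sum fun i _ => h _ _

/-- Only countably many points of a level set are isolated in it from the right; at any other one a
nonzero derivative is impossible. Hence, for almost every time spent on a side of a square, the
velocity is parallel to that side. -/
lemma ae_deriv_eq_zero_of_eq (f : ℝ → ℝ) (c : ℝ) :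
    ∀ᵐ t, f t = c → DifferentiableAt ℝ f t → deriv f t = 0 := by
  have hc := countable_setOfPred_isolated_right_within (s := {t | f t = c})
  filter_upwards [hc.ae_notMem volume] with t ht hft hd
  by_contra hne
  refine ht ⟨hft, ?_⟩
  have h1 := (hd.hasDerivAt.eventually_ne (c := c) hne).filter_mono
    (nhdsWithin_mono t (s := {t | f t = c} ∩ Set.Ioi t) fun s hs => hs.2.ne')
  have h2 : ∀ᶠ s in 𝓝[{t | f t = c} ∩ Set.Ioi t] t, f s = c := by
    filter_upwards [self_mem_nhdsWithin] with s hs using hs.1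
  exact Filter.eventually_false_iff_eq_bot.1 ((h1.and h2).mono fun s hs => hs.1 hs.2)

lemma ae_deriv_eq_zero_of_int (f : ℝ → ℝ) :
    ∀ᵐ t, DifferentiableAt ℝ f t → ∀ m : ℤ, f t = m → deriv f t = 0 := by
  filter_upwards [ae_all_iff.2 fun m : ℤ => ae_deriv_eq_zero_of_eq f m] with t ht hd m hm
  exact ht m hm hd

lemma abs_deriv_le_of_abs_sub_le {E F : Type*} [NormedAddCommGroup E] [NormedSpace ℝ E]
    [NormedAddCommGroup F] [NormedSpace ℝ F] {w : ℝ → ℝ} {f : ℝ → E} {g : ℝ → F} {w' : ℝ}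
    {f' : E} {g' : F} {t A B : ℝ} (hw : HasDerivAt w w' t) (hf : HasDerivAt f f' t)
    (hg : HasDerivAt g g' t)
    (h : ∀ᶠ s in 𝓝 t, |w s - w t| ≤ A * ‖f s - f t‖ + B * ‖g s - g t‖) :
    |w'| ≤ A * ‖f'‖ + B * ‖g'‖ := by
  have h1 := (hasDerivAt_iff_tendsto_slope.1 hw).norm
  have h2 := ((hasDerivAt_iff_tendsto_slope.1 hf).norm.const_mul A).add
    ((hasDerivAt_iff_tendsto_slope.1 hg).norm.const_mul B)
  rw [← Real.norm_eq_abs]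
  refine le_of_tendsto_of_tendsto h1 h2 ?_
  filter_upwards [h.filter_mono nhdsWithin_le_nhds] with s hs
  simp only [slope_def_module, norm_smul]
  rw [← Real.norm_eq_abs] at hs
  have := mul_le_mul_of_nonneg_left hs (norm_nonneg (s - t)⁻¹)
  linarith

lemma isOpen_darkRegion : IsOpen darkRegion := by
  have : darkRegion = ⋃ (i : ℤ) (j : ℤ) (_ : Odd (i + j)),
      {P : Plane | P 0 ∈ Set.Ioo (i : ℝ) (i + 1)} ∩ {P : Plane | P 1 ∈ Set.Ioo (j : ℝ) (j + 1)} := by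
    ext P
    simp only [darkRegion, Set.mem_iUnion, Set.mem_inter_iff, Set.mem_ofPred_eq, exists_prop]
  rw [this]
  refine isOpen_iUnion fun i => isOpen_iUnion fun j => isOpen_iUnion fun _ => ?_
  exact (isOpen_Ioo.preimage (by fun_prop)).inter (isOpen_Ioo.preimage (by fun_prop))

lemma one_le_refractiveIndex {β : ℝ} (hβ : 1 ≤ β) (P : Plane) : 1 ≤ refractiveIndex β P := by
  rw [refractiveIndex]
  split_ifs
  exacts [hβ, le_rfl]

lemma refractiveIndex_le {b β : ℝ} (hβ : b ≤ β) (P : Plane) :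
    refractiveIndex b P ≤ refractiveIndex β P := by
  rw [refractiveIndex, refractiveIndex]
  split_ifs
  exacts [hβ, le_rfl]

lemma measurable_refractiveIndex (β : ℝ) : Measurable (refractiveIndex β) := by
  unfold refractiveIndex
  exact Measurable.ite isOpen_darkRegion.measurableSet measurable_const measurable_const

lemma norm_plane (P : Plane) : ‖P‖ = √(P 0 ^ 2 + P 1 ^ 2) := by
  rw [EuclideanSpace.norm_eq, Fin.sum_univ_two, Real.norm_eq_abs, Real.norm_eq_abs, sq_abs, sq_abs]

lemma hasDerivAt_coord {u : ℝ → Plane} {u' : Plane} {t : ℝ} (h : HasDerivAt u u' t) (i : Fin 2) :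
    HasDerivAt (fun t => u t i) (u' i) t :=
  (EuclideanSpace.proj (𝕜 := ℝ) i).hasFDerivAt.comp_hasDerivAt t h

lemma absolutelyContinuous_coord {u : ℝ → Plane} {a b : ℝ}
    (hu : AbsolutelyContinuousOnInterval u a b) (i : Fin 2) :
    AbsolutelyContinuousOnInterval (fun t => u t i) a b := by
  refine absolutelyContinuousOnInterval_of_dist_le (C := 1) hu fun s t => ?_
  rw [one_mul, dist_eq_norm, dist_eq_norm]
  exact PiLp.norm_apply_le (u s - u t) i

lemma ae_differentiableAt_plane {u : ℝ → Plane} {a b : ℝ}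
    (hu : AbsolutelyContinuousOnInterval u a b) :
    ∀ᵐ t, t ∈ Set.uIcc a b → DifferentiableAt ℝ u t :=
  hu.boundedVariationOn.ae_differentiableAt_of_mem_uIcc

lemma intervalIntegrable_opticalSpeed {u : ℝ → Plane} {a b : ℝ} (hab : a ≤ b)
    (hu : AbsolutelyContinuousOnInterval u a b) {β : ℝ} (hβ : 1 ≤ β) :
    IntervalIntegrable (fun t => refractiveIndex β (u t) * ‖deriv u t‖) volume a b := by
  have h0 := (absolutelyContinuous_coord hu 0).intervalIntegrable_deriv.norm
  have h1 := (absolutelyContinuous_coord hu 1).intervalIntegrable_deriv.norm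
  have hs := (h0.add h1).const_mul β
  have hc : AEMeasurable u (volume.restrict (Set.Ioc a b)) := by
    have := hu.continuousOn
    rw [Set.uIcc_of_le hab] at this
    exact ((this.mono Set.Ioc_subset_Icc_self).aestronglyMeasurable measurableSet_Ioc).aemeasurable
  refine hs.mono_fun' ?_ ?_
  · rw [Set.uIoc_of_le hab]
    exact (((measurable_refractiveIndex β).comp_aemeasurable hc).mul
      (measurable_deriv u).norm.aemeasurable).aestronglyMeasurable
  · rw [Set.uIoc_of_le hab, EventuallyLE, ae_restrict_iff' measurableSet_Ioc]
    filter_upwards [ae_differentiableAt_plane hu] with t ht htm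
    rw [Set.uIcc_of_le hab] at ht
    have hd := (ht (Set.Ioc_subset_Icc_self htm)).hasDerivAt
    have e0 := (hasDerivAt_coord hd 0).deriv
    have e1 := (hasDerivAt_coord hd 1).deriv
    have p := one_le_refractiveIndex hβ (u t)
    have q : refractiveIndex β (u t) ≤ β := by
      rw [refractiveIndex]; split_ifs; exacts [le_rfl, hβ]
    rw [Real.norm_of_nonneg (by positivity)]
    simp only [e0, e1]
    refine mul_le_mul q ?_ (norm_nonneg _) (by linarith)
    rw [norm_plane]
    refine Real.sqrt_le_iff.2 ⟨by positivity, ?_⟩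
    rw [Real.norm_eq_abs, Real.norm_eq_abs]
    nlinarith [abs_nonneg (deriv u t 0), abs_nonneg (deriv u t 1), sq_abs (deriv u t 0),
      sq_abs (deriv u t 1)]

lemma intervalIntegrable_norm_deriv {u : ℝ → Plane} {a b : ℝ} (hab : a ≤ b)
    (hu : AbsolutelyContinuousOnInterval u a b) :
    IntervalIntegrable (fun t => ‖deriv u t‖) volume a b := by
  simpa [refractiveIndex] using intervalIntegrable_opticalSpeed hab hu le_rfl

lemma dist_le_integral_norm_deriv {u : ℝ → Plane} {a b : ℝ} (hab : a ≤ b)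
    (hu : AbsolutelyContinuousOnInterval u a b) :
    ‖u b - u a‖ ≤ ∫ t in a..b, ‖deriv u t‖ := by
  have hn := intervalIntegrable_norm_deriv hab hu
  set e := u b - u a with he
  -- Testing against the chord `e` reduces the estimate to the scalar fundamental theorem of
  -- calculus.
  have hf : AbsolutelyContinuousOnInterval (fun t => inner ℝ e (u t)) a b := by
    refine absolutelyContinuousOnInterval_of_dist_le (C := ‖e‖) hu fun s t => ?_
    rw [Real.dist_eq, ← inner_sub_right, dist_eq_norm]
    exact abs_real_inner_le_norm _ _
  have h1 := hf.integral_deriv_eq_sub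
  have h2 : ∫ t in a..b, deriv (fun t => inner ℝ e (u t)) t ≤ ∫ t in a..b, ‖e‖ * ‖deriv u t‖ := by
    refine intervalIntegral.integral_mono_ae_restrict hab hf.intervalIntegrable_deriv
      (hn.const_mul _) ?_
    rw [EventuallyLE, ae_restrict_iff' measurableSet_Icc]
    filter_upwards [ae_differentiableAt_plane hu] with t ht htm
    rw [Set.uIcc_of_le hab] at ht
    have hd := (ht htm).hasDerivAt
    have hd' : HasDerivAt (fun t => inner ℝ e (u t)) (inner ℝ e (deriv u t)) t :=
      (innerSL ℝ e).hasFDerivAt.comp_hasDerivAt t hd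
    rw [hd'.deriv]
    exact real_inner_le_norm _ _
  rw [h1, ← inner_sub_right, ← he, real_inner_self_eq_norm_sq, intervalIntegral.integral_const_mul]
    at h2
  rcases (norm_nonneg e).eq_or_lt with h | h
  · rw [← h]
    exact intervalIntegral.integral_nonneg hab fun t _ => norm_nonneg _
  · rw [sq] at h2
    exact le_of_mul_le_mul_left h2 h

end

/-! ### The calibration inequality along a curve, and its equality case. -/

section

variable {b : ℝ} {δ : ℝ → ℝ → ℝ}

/-- The calibration evaluated along a curve. -/
noncomputable def calibrationAlong (δ : ℝ → ℝ → ℝ) (u : ℝ → Plane) (t : ℝ) : ℝ :=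
  calibration δ (u t 0) (u t 1)

lemma absolutelyContinuous_calibrationAlong (hb : 1 < b) (hδ : IsDarkProfile b δ)
    {u : ℝ → Plane} {s t : ℝ} (hu : AbsolutelyContinuousOnInterval u s t) :
    AbsolutelyContinuousOnInterval (calibrationAlong δ u) s t := by
  refine absolutelyContinuousOnInterval_of_dist_le (C := 2 * b) hu fun s t => ?_
  have h0 := PiLp.norm_apply_le (u s - u t) 0
  have h1 := PiLp.norm_apply_le (u s - u t) 1
  have := calibration_lipschitz hb hδ (u s 0) (u s 1) (u t 0) (u t 1)
  rw [Real.dist_eq, dist_eq_norm]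
  simp only [PiLp.sub_apply, Real.norm_eq_abs] at h0 h1
  refine this.trans ?_
  nlinarith

/-- Inside a cell this is the Lipschitz bound of that cell. On a side, `φ` may fail to be
differentiable and the index is only `1`, so the velocity has to be tangential: the normal
displacement, weighted by `b`, then contributes nothing to the derivative, and the tangential
variation of `φ` has constant `1`. -/
lemma calibrationAlong_deriv_le (hb : 1 < b) (hδ : IsDarkProfile b δ) {u : ℝ → Plane} {t w' : ℝ}
    {u' : Plane} (hu : HasDerivAt u u' t) (hw : HasDerivAt (calibrationAlong δ u) w' t)
    (h0 : ∀ m : ℤ, u t 0 = m → u' 0 = 0) (h1 : ∀ m : ℤ, u t 1 = m → u' 1 = 0) :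
    w' ≤ refractiveIndex b (u t) * ‖u'‖ := by
  have d0 := hasDerivAt_coord hu 0
  have d1 := hasDerivAt_coord hu 1
  refine (le_abs_self _).trans ?_
  have hone : ‖u'‖ ≤ refractiveIndex b (u t) * ‖u'‖ :=
    le_mul_of_one_le_left (norm_nonneg _) (one_le_refractiveIndex hb.le _)
  by_cases hy : ∃ m : ℤ, u t 1 = m
  · obtain ⟨m, hm⟩ := hy
    refine le_trans ?_ hone
    have := abs_deriv_le_of_abs_sub_le (A := b) (B := 1) hw d1 d0 (Eventually.of_forall fun s => ?_)
    · rw [h1 m hm, norm_zero, mul_zero, zero_add, one_mul] at this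
      exact this.trans (PiLp.norm_apply_le u' 0)
    · have i1 := calibration_lipschitz hb hδ (u s 0) (u s 1) (u s 0) (u t 1)
      rw [sub_self, abs_zero, mul_zero, zero_add] at i1
      have i2 : calibration δ (u s 0) (u t 1) - calibration δ (u t 0) (u t 1) =
          u s 0 - u t 0 := by
        rw [hm, calibration_horizontal hδ, calibration_horizontal hδ]; ring
      have i3 := abs_sub_le (calibration δ (u s 0) (u s 1)) (calibration δ (u s 0) (u t 1))
        (calibration δ (u t 0) (u t 1))
      rw [i2] at i3
      rw [Real.norm_eq_abs, Real.norm_eq_abs, one_mul]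
      exact i3.trans (by linarith)
  by_cases hx : ∃ m : ℤ, u t 0 = m
  · obtain ⟨m, hm⟩ := hx
    refine le_trans ?_ hone
    have := abs_deriv_le_of_abs_sub_le (A := b) (B := 1) hw d0 d1 (Eventually.of_forall fun s => ?_)
    · rw [h0 m hm, norm_zero, mul_zero, zero_add, one_mul] at this
      exact this.trans (PiLp.norm_apply_le u' 1)
    · have i1 := calibration_lipschitz hb hδ (u s 0) (u s 1) (u t 0) (u s 1)
      rw [sub_self, abs_zero, mul_zero, add_zero] at i1
      have i2 : |calibration δ (u t 0) (u s 1) - calibration δ (u t 0) (u t 1)| ≤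
          |u s 1 - u t 1| := by
        rw [hm]; exact calibration_vertical_lipschitz hδ _ _ _
      have i3 := abs_sub_le (calibration δ (u s 0) (u s 1)) (calibration δ (u t 0) (u s 1))
        (calibration δ (u t 0) (u t 1))
      rw [Real.norm_eq_abs, Real.norm_eq_abs, one_mul]
      exact i3.trans (by linarith)
  push Not at hx hy
  have mx : u t 0 ∈ Set.Ioo (⌊u t 0⌋ : ℝ) (⌊u t 0⌋ + 1) :=
    ⟨lt_of_le_of_ne (Int.floor_le _) (hx _).symm, Int.lt_floor_add_one _⟩
  have my : u t 1 ∈ Set.Ioo (⌊u t 1⌋ : ℝ) (⌊u t 1⌋ + 1) :=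
    ⟨lt_of_le_of_ne (Int.floor_le _) (hy _).symm, Int.lt_floor_add_one _⟩
  have ev := (d0.continuousAt.eventually_mem (isOpen_Ioo.mem_nhds mx)).and
    (d1.continuousAt.eventually_mem (isOpen_Ioo.mem_nhds my))
  have hnorm : ∀ s, √((u s 0 - u t 0) ^ 2 + (u s 1 - u t 1) ^ 2) = ‖u s - u t‖ := by
    intro s
    rw [norm_plane, PiLp.sub_apply, PiLp.sub_apply]
  rcases Int.even_or_odd (⌊u t 0⌋ + ⌊u t 1⌋) with hp | hp
  · refine le_trans ?_ hone
    have := abs_deriv_le_of_abs_sub_le (A := 1) (B := 0) hw hu hu ?_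
    · simpa using this
    · filter_upwards [ev] with s hs
      rw [zero_mul, add_zero, one_mul, ← hnorm]
      exact calibration_light_lipschitz hδ hp (Set.Ioo_subset_Icc_self hs.1)
        (Set.Ioo_subset_Icc_self hs.2) (Set.Ioo_subset_Icc_self mx) (Set.Ioo_subset_Icc_self my)
  · have hdark : refractiveIndex b (u t) = b := by
      rw [refractiveIndex, if_pos ⟨_, _, hp, mx, my⟩]
    rw [hdark]
    have := abs_deriv_le_of_abs_sub_le (A := b) (B := 0) hw hu hu ?_
    · simpa using this
    · filter_upwards [ev] with s hs
      rw [zero_mul, add_zero, ← hnorm]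
      exact calibration_dark_lipschitz hδ hp (Set.Ioo_subset_Icc_self hs.1)
        (Set.Ioo_subset_Icc_self hs.2) (Set.Ioo_subset_Icc_self mx) (Set.Ioo_subset_Icc_self my)

lemma ae_calibrationAlong_deriv_le (hb : 1 < b) (hδ : IsDarkProfile b δ) {u : ℝ → Plane} {s t : ℝ}
    (hu : AbsolutelyContinuousOnInterval u s t) :
    ∀ᵐ r, r ∈ Set.uIcc s t →
      deriv (calibrationAlong δ u) r ≤ refractiveIndex b (u r) * ‖deriv u r‖ := by
  filter_upwards [ae_differentiableAt_plane hu,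
    (absolutelyContinuous_calibrationAlong hb hδ hu).ae_differentiableAt,
    ae_deriv_eq_zero_of_int (fun t => u t 0), ae_deriv_eq_zero_of_int (fun t => u t 1)]
    with r h1 h2 h3 h4 hr
  have hd := (h1 hr).hasDerivAt
  have d0 := hasDerivAt_coord hd 0
  have d1 := hasDerivAt_coord hd 1
  refine calibrationAlong_deriv_le hb hδ hd (h2 hr).hasDerivAt ?_ ?_
  · intro m hm
    rw [← d0.deriv]
    exact h3 d0.differentiableAt m hm
  · intro m hm
    rw [← d1.deriv]
    exact h4 d1.differentiableAt m hm

/-- Along a curve whose optical length does not exceed the variation of the calibration, the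
calibration measures the optical length of every arc. -/
lemma calibrationAlong_sub_eq_integral {β : ℝ} (hb : 1 < b) (hbβ : b ≤ β) (hδ : IsDarkProfile b δ)
    {u : ℝ → Plane} (hu : AbsolutelyContinuousOnInterval u 0 1)
    (hopt : opticalLength β u ≤ calibrationAlong δ u 1 - calibrationAlong δ u 0) {s t : ℝ}
    (hs : 0 ≤ s) (hst : s ≤ t) (ht : t ≤ 1) :
    calibrationAlong δ u t - calibrationAlong δ u s =
      ∫ r in s..t, refractiveIndex β (u r) * ‖deriv u r‖ := by
  have hβ : 1 ≤ β := hb.le.trans hbβ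
  have hw := absolutelyContinuous_calibrationAlong hb hδ hu
  have hle : ∀ s t, 0 ≤ s → s ≤ t → t ≤ 1 →
      calibrationAlong δ u t - calibrationAlong δ u s ≤
        ∫ r in s..t, refractiveIndex β (u r) * ‖deriv u r‖ := by
    intro s t hs hst ht
    have hsub : Set.uIcc s t ⊆ Set.uIcc 0 1 := by
      rw [Set.uIcc_of_le hst, Set.uIcc_of_le zero_le_one]
      exact Set.Icc_subset_Icc hs ht
    have hu' := hu.mono hsub
    have hw' := hw.mono hsub
    rw [← hw'.integral_deriv_eq_sub]
    refine intervalIntegral.integral_mono_ae_restrict hst hw'.intervalIntegrable_deriv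
      (intervalIntegrable_opticalSpeed hst hu' hβ) ?_
    rw [EventuallyLE, ae_restrict_iff' measurableSet_Icc]
    filter_upwards [ae_calibrationAlong_deriv_le hb hδ hu'] with r hr hrm
    rw [Set.uIcc_of_le hst] at hr
    exact (hr hrm).trans (mul_le_mul_of_nonneg_right (refractiveIndex_le hbβ _) (norm_nonneg _))
  have hint : ∀ s t, 0 ≤ s → s ≤ t → t ≤ 1 →
      IntervalIntegrable (fun r => refractiveIndex β (u r) * ‖deriv u r‖) volume s t := by
    intro s t hs hst ht
    refine intervalIntegrable_opticalSpeed hst (hu.mono ?_) hβ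
    rw [Set.uIcc_of_le hst, Set.uIcc_of_le zero_le_one]
    exact Set.Icc_subset_Icc hs ht
  -- The inequality holds on each of the three arcs and their sum is an equality, so each one is an
  -- equality.
  have a1 := hle 0 s le_rfl hs (hst.trans ht)
  have a2 := hle s t hs hst ht
  have a3 := hle t 1 (hs.trans hst) ht le_rfl
  have e1 := intervalIntegral.integral_add_adjacent_intervals
    (hint 0 s le_rfl hs (hst.trans ht)) (hint s t hs hst ht)
  have e2 := intervalIntegral.integral_add_adjacent_intervals
    (hint 0 t le_rfl (hs.trans hst) ht) (hint t 1 (hs.trans hst) ht le_rfl)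
  rw [opticalLength] at hopt
  linarith

lemma norm_sub_le_calibrationAlong_sub {β : ℝ} (hb : 1 < b) (hbβ : b ≤ β)
    (hδ : IsDarkProfile b δ) {u : ℝ → Plane} (hu : AbsolutelyContinuousOnInterval u 0 1)
    (hopt : opticalLength β u ≤ calibrationAlong δ u 1 - calibrationAlong δ u 0)
    {c s t : ℝ} (hs : 0 ≤ s) (hst : s ≤ t) (ht : t ≤ 1) (hc0 : 0 ≤ c)
    (hc : ∀ r ∈ Set.Icc s t, c ≤ refractiveIndex β (u r)) :
    c * ‖u t - u s‖ ≤ calibrationAlong δ u t - calibrationAlong δ u s := by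
  have hsub : Set.uIcc s t ⊆ Set.uIcc 0 1 := by
    rw [Set.uIcc_of_le hst, Set.uIcc_of_le zero_le_one]
    exact Set.Icc_subset_Icc hs ht
  have hu' := hu.mono hsub
  have hβ : 1 ≤ β := hb.le.trans hbβ
  have hn := intervalIntegrable_norm_deriv hst hu'
  rw [calibrationAlong_sub_eq_integral hb hbβ hδ hu hopt hs hst ht]
  calc c * ‖u t - u s‖ ≤ c * ∫ r in s..t, ‖deriv u r‖ :=
        mul_le_mul_of_nonneg_left (dist_le_integral_norm_deriv hst hu') hc0
    _ = ∫ r in s..t, c * ‖deriv u r‖ := (intervalIntegral.integral_const_mul _ _).symm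
    _ ≤ _ := by
      refine intervalIntegral.integral_mono_on hst (hn.const_mul c)
        (intervalIntegrable_opticalSpeed hst hu' hβ) fun r hr => ?_
      exact mul_le_mul_of_nonneg_right (hc r hr) (norm_nonneg _)

end

/-! ### First exit from, and last entrance into, an open set. -/

section

variable {X : Type*} [TopologicalSpace X] {u : ℝ → X} {a c : ℝ}

/-- The last clause carries closed conditions valid before the exit over to the exit point. -/
lemma exists_first_exit (hac : a ≤ c) (hu : ContinuousOn u (Set.Icc a c)) {U : Set X}
    (hU : IsOpen U) (ha : u a ∈ U) (hc : u c ∉ U) :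
    ∃ s ∈ Set.Ioc a c, u s ∉ U ∧ (∀ r ∈ Set.Ico a s, u r ∈ U) ∧
      ∀ C : Set X, IsClosed C → (∀ r ∈ Set.Ico a s, u r ∈ C) → u s ∈ C := by
  have hcl := hu.preimage_isClosed_of_isClosed isClosed_Icc hU.isClosed_compl
  have hcomp := isCompact_Icc.of_isClosed_subset hcl Set.inter_subset_left
  obtain ⟨s, ⟨hs, hsU⟩, hleast⟩ := hcomp.exists_isLeast ⟨c, ⟨hac, le_rfl⟩, hc⟩
  have has : a < s := lt_of_le_of_ne hs.1 (by rintro rfl; exact hsU ha)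
  refine ⟨s, ⟨has, hs.2⟩, hsU, fun r hr => ?_, fun C hC h => ?_⟩
  · by_contra hcon
    exact absurd (hleast ⟨⟨hr.1, hr.2.le.trans hs.2⟩, hcon⟩) (not_le.2 hr.2)
  · have hcont : ContinuousWithinAt u (Set.Ico a s) s :=
      (hu s hs).mono fun r hr => ⟨hr.1, hr.2.le.trans hs.2⟩
    have hm : s ∈ closure (Set.Ico a s) := by
      rw [closure_Ico has.ne]; exact ⟨has.le, le_rfl⟩
    have := hcont.mem_closure hm h
    rwa [hC.closure_eq] at this

lemma exists_last_entrance (hac : a ≤ c) (hu : ContinuousOn u (Set.Icc a c)) {U : Set X}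
    (hU : IsOpen U) (ha : u a ∉ U) (hc : u c ∈ U) :
    ∃ s ∈ Set.Ico a c, u s ∉ U ∧ (∀ r ∈ Set.Ioc s c, u r ∈ U) ∧
      ∀ C : Set X, IsClosed C → (∀ r ∈ Set.Ioc s c, u r ∈ C) → u s ∈ C := by
  have hv : ContinuousOn (fun t => u (-t)) (Set.Icc (-c) (-a)) :=
    hu.comp continuousOn_neg fun t ht => ⟨by linarith [ht.2], by linarith [ht.1]⟩
  obtain ⟨s, hs, h1, h2, h3⟩ := exists_first_exit (neg_le_neg hac) hv hU (by simpa using hc)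
    (by simpa using ha)
  refine ⟨-s, ⟨by linarith [hs.2], by linarith [hs.1]⟩, h1, fun r hr => ?_, fun C hC h => ?_⟩
  · simpa using h2 (-r) ⟨by linarith [hr.2], by linarith [hr.1]⟩
  · exact h3 C hC fun r hr => h (-r) ⟨by linarith [hr.2], by linarith [hr.1]⟩

end

/-! ### Rigidity of calibrated curves. -/

section

variable {b β : ℝ} {δ : ℝ → ℝ → ℝ} {u : ℝ → Plane}

lemma not_int_of_mem_Ioo {h m : ℤ} {y : ℝ} (hy : y = m) (h1 : (h : ℝ) < y) (h2 : y < h + 1) :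
    False := by
  rw [hy] at h1 h2
  have h1' : h < m := by exact_mod_cast h1
  have h2' : m < h + 1 := by exact_mod_cast h2
  omega

/-- Until it leaves an open dark square, the curve satisfies `β ‖u r - u t‖ ≤ b ‖u r - u t‖`, so it
stands still. It could then never leave, although its final ordinate is an integer. -/
lemma not_mem_darkRegion_of_calibrated (hb : 1 < b) (hbβ : b < β) (hδ : IsDarkProfile b δ)
    (hu : AbsolutelyContinuousOnInterval u 0 1)
    (hopt : opticalLength β u ≤ calibrationAlong δ u 1 - calibrationAlong δ u 0)
    (h1 : ∃ m : ℤ, u 1 1 = m) {t : ℝ} (ht : t ∈ Set.Icc (0 : ℝ) 1) : u t ∉ darkRegion := by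
  rintro ⟨i, h, hp, hx, hy⟩
  have hcont := hu.continuousOn
  rw [Set.uIcc_of_le zero_le_one] at hcont
  let U : Set Plane := {P | P 0 ∈ Set.Ioo (i : ℝ) (i + 1) ∧ P 1 ∈ Set.Ioo (h : ℝ) (h + 1)}
  have hU : IsOpen U :=
    (isOpen_Ioo.preimage (by fun_prop : Continuous fun P : Plane => P 0)).inter
      (isOpen_Ioo.preimage (by fun_prop : Continuous fun P : Plane => P 1))
  obtain ⟨m, hm⟩ := h1
  obtain ⟨s, hs, hsU, hr, hC⟩ := exists_first_exit ht.2
    (hcont.mono (Set.Icc_subset_Icc_left ht.1)) hU ⟨hx, hy⟩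
    (fun hc => not_int_of_mem_Ioo hm hc.2.1 hc.2.2)
  have hconst : ∀ r ∈ Set.Ico t s, u r ∈ ({u t} : Set Plane) := by
    intro r hrm
    have i1 := norm_sub_le_calibrationAlong_sub (c := β) hb hbβ.le hδ hu hopt ht.1 hrm.1
      (hrm.2.le.trans hs.2) (by linarith) (fun q hq => by
        have hq' := hr q ⟨hq.1, hq.2.trans_lt hrm.2⟩
        rw [refractiveIndex, if_pos ⟨i, h, hp, hq'.1, hq'.2⟩])
    have hr' := hr r hrm
    have i2 := calibration_dark_lipschitz hδ hp (Set.Ioo_subset_Icc_self hr'.1)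
      (Set.Ioo_subset_Icc_self hr'.2) (Set.Ioo_subset_Icc_self hx) (Set.Ioo_subset_Icc_self hy)
    have i3 : √((u r 0 - u t 0) ^ 2 + (u r 1 - u t 1) ^ 2) = ‖u r - u t‖ := by
      rw [norm_plane, PiLp.sub_apply, PiLp.sub_apply]
    rw [i3] at i2
    have i4 := (le_abs_self _).trans i2
    have i5 : β * ‖u r - u t‖ ≤ b * ‖u r - u t‖ := i1.trans i4
    have i6 : ‖u r - u t‖ ≤ 0 := by
      by_contra! hc
      nlinarith
    exact sub_eq_zero.1 (norm_le_zero_iff.1 i6)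
  have := hC {u t} isClosed_singleton hconst
  rw [Set.mem_singleton_iff] at this
  exact hsU (this ▸ ⟨hx, hy⟩)

/-- In the lower triangle `φ` is a constant plus the distance from the vertex `(i, h)`, so a
calibrated curve can only recede from it along a ray. The ray meets neither the base nor the
diagonal again, and beyond the right side lies a dark square; hence the curve could not reach its
final integer ordinate. -/
lemma not_mem_lower_triangle (hδ : IsDarkProfile b δ) (hu : ContinuousOn u (Set.Icc 0 1))
    (hlen : ∀ s t, 0 ≤ s → s ≤ t → t ≤ 1 →
      ‖u t - u s‖ ≤ calibrationAlong δ u t - calibrationAlong δ u s)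
    (hdark : ∀ t ∈ Set.Icc (0 : ℝ) 1, u t ∉ darkRegion)
    (h1 : ∃ m : ℤ, u 1 1 = m) {t : ℝ} (ht : t ∈ Set.Icc (0 : ℝ) 1) {i h : ℤ} (hp : Even (i + h))
    (hy : h < u t 1) (hxy : u t 1 - h < u t 0 - i) : i + 1 < u t 0 := by
  by_contra! hx
  -- The bound `i + 2` instead of `i + 1` adds the right side and part of the dark square next to
  -- it. As the dark region is avoided, the curve inside `U` remains in the closed triangle `C`, and
  -- an exit point on the ray would still belong to `U`.
  let U : Set Plane := {P | ((h : ℝ) < P 1 ∧ P 1 < h + 1) ∧ (P 1 - h < P 0 - i ∧ P 0 < i + 2)}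
  have hU : IsOpen U := by
    refine IsOpen.and (IsOpen.and (isOpen_lt ?_ ?_) (isOpen_lt ?_ ?_))
      (IsOpen.and (isOpen_lt ?_ ?_) (isOpen_lt ?_ ?_)) <;> fun_prop
  let C : Set Plane := {P | (h : ℝ) ≤ P 1 ∧ P 1 - h ≤ P 0 - i ∧ P 0 ≤ i + 1}
  have hCc : IsClosed C := by
    refine IsClosed.and (isClosed_le ?_ ?_)
      (IsClosed.and (isClosed_le ?_ ?_) (isClosed_le ?_ ?_)) <;> fun_prop
  obtain ⟨m, hm⟩ := h1
  obtain ⟨s, hs, hsU, hr, hC⟩ := exists_first_exit ht.2 (hu.mono (Set.Icc_subset_Icc_left ht.1)) hU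
    ⟨⟨hy, by linarith⟩, hxy, by linarith⟩ (fun hc => not_int_of_mem_Ioo hm hc.1.1 hc.1.2)
  have hsC : u s ∈ C := by
    refine hC C hCc fun r hrm => ?_
    obtain ⟨⟨a1, a2⟩, a3, a4⟩ := hr r hrm
    refine ⟨a1.le, a3.le, ?_⟩
    by_contra! hc
    refine hdark r ⟨ht.1.trans hrm.1, hrm.2.le.trans hs.2⟩ ⟨i + 1, h, ?_, ⟨?_, ?_⟩, a1, a2⟩
    · rw [add_right_comm]; exact hp.add_one
    · push_cast; exact hc
    · push_cast; linarith
  obtain ⟨b1, b2, b3⟩ := hsC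
  have hl := hlen t s ht.1 hs.1.le hs.2
  rw [calibrationAlong, calibrationAlong, calibration_lower hδ hp b3 b1 b2,
    calibration_lower hδ hp hx hy.le hxy.le, norm_plane, PiLp.sub_apply, PiLp.sub_apply,
    add_sub_add_left_eq_sub] at hl
  obtain ⟨k, hk, e0, e1⟩ := eq_mul_of_dist_add_le (a := u s 0 - i) (b := u s 1 - h)
    (c := u t 0 - i) (d := u t 1 - h) (by linarith) (by simpa only [sub_sub_sub_cancel_right] using hl)
  have p1 : 0 < u s 1 - h := by rw [e1]; nlinarith
  have p2 : u s 1 - h < u s 0 - i := by rw [e0, e1]; nlinarith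
  exact hsU ⟨⟨by linarith, by linarith⟩, p2, by linarith⟩

/-- The mirror argument, run backwards in time: here `φ` is a constant minus the distance to the
vertex `(i + 1, h + 1)`, and the initial ordinate is an integer. -/
lemma not_mem_upper_triangle (hδ : IsDarkProfile b δ) (hu : ContinuousOn u (Set.Icc 0 1))
    (hlen : ∀ s t, 0 ≤ s → s ≤ t → t ≤ 1 →
      ‖u t - u s‖ ≤ calibrationAlong δ u t - calibrationAlong δ u s)
    (hdark : ∀ t ∈ Set.Icc (0 : ℝ) 1, u t ∉ darkRegion)
    (h0 : ∃ m : ℤ, u 0 1 = m) {t : ℝ} (ht : t ∈ Set.Icc (0 : ℝ) 1) {i h : ℤ} (hp : Even (i + h))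
    (hy : u t 1 < h + 1) (hxy : u t 0 - i < u t 1 - h) : u t 0 < i := by
  by_contra! hx
  let U : Set Plane := {P | ((h : ℝ) < P 1 ∧ P 1 < h + 1) ∧ (P 0 - i < P 1 - h ∧ (i : ℝ) - 1 < P 0)}
  have hU : IsOpen U := by
    refine IsOpen.and (IsOpen.and (isOpen_lt ?_ ?_) (isOpen_lt ?_ ?_))
      (IsOpen.and (isOpen_lt ?_ ?_) (isOpen_lt ?_ ?_)) <;> fun_prop
  let C : Set Plane := {P | P 1 ≤ h + 1 ∧ P 0 - i ≤ P 1 - h ∧ (i : ℝ) ≤ P 0}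
  have hCc : IsClosed C := by
    refine IsClosed.and (isClosed_le ?_ ?_)
      (IsClosed.and (isClosed_le ?_ ?_) (isClosed_le ?_ ?_)) <;> fun_prop
  obtain ⟨m, hm⟩ := h0
  obtain ⟨s, hs, hsU, hr, hC⟩ := exists_last_entrance ht.1
    (hu.mono (Set.Icc_subset_Icc_right ht.2)) hU
    (fun hc => not_int_of_mem_Ioo hm hc.1.1 hc.1.2) ⟨⟨by linarith, hy⟩, hxy, by linarith⟩
  have hsC : u s ∈ C := by
    refine hC C hCc fun r hrm => ?_
    obtain ⟨⟨a1, a2⟩, a3, a4⟩ := hr r hrm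
    refine ⟨a2.le, a3.le, ?_⟩
    by_contra! hc
    refine hdark r ⟨hs.1.trans hrm.1.le, hrm.2.trans ht.2⟩ ⟨i - 1, h, ?_, ⟨?_, ?_⟩, a1, a2⟩
    · rw [sub_add_eq_add_sub]; exact hp.sub_odd odd_one
    · push_cast; exact a4
    · push_cast; linarith
  obtain ⟨b1, b2, b3⟩ := hsC
  have hl := hlen s t hs.1 hs.2.le ht.2
  rw [calibrationAlong, calibrationAlong, calibration_upper hδ hp b3 b1 b2,
    calibration_upper hδ hp hx hy.le hxy.le, norm_plane, PiLp.sub_apply, PiLp.sub_apply,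
    sub_sub_sub_cancel_left] at hl
  obtain ⟨k, hk, e0, e1⟩ := eq_mul_of_dist_add_le (a := i + 1 - u s 0) (b := h + 1 - u s 1)
    (c := i + 1 - u t 0) (d := h + 1 - u t 1) (by linarith)
    (by simpa only [sub_sub_sub_cancel_left] using hl)
  have p1 : 0 < h + 1 - u s 1 := by rw [e1]; nlinarith
  have p2 : h + 1 - u s 1 < i + 1 - u s 0 := by rw [e0, e1]; nlinarith
  exact hsU ⟨⟨by linarith, by linarith⟩, by linarith, by linarith⟩

/-- A calibrated curve runs along the integer horizontal lines and the light diagonals. -/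
lemma mem_net_of_calibrated (hδ : IsDarkProfile b δ) (hu : ContinuousOn u (Set.Icc 0 1))
    (hlen : ∀ s t, 0 ≤ s → s ≤ t → t ≤ 1 →
      ‖u t - u s‖ ≤ calibrationAlong δ u t - calibrationAlong δ u s)
    (hdark : ∀ t ∈ Set.Icc (0 : ℝ) 1, u t ∉ darkRegion)
    (h0 : ∃ m : ℤ, u 0 1 = m) (h1 : ∃ m : ℤ, u 1 1 = m) {t : ℝ} (ht : t ∈ Set.Icc (0 : ℝ) 1) :
    (∃ m : ℤ, u t 1 = m) ∨ ∃ k : ℤ, u t 0 - u t 1 = 2 * k := by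
  by_contra! hc
  obtain ⟨hy, hd⟩ := hc
  have my1 : (⌊u t 1⌋ : ℝ) < u t 1 := lt_of_le_of_ne (Int.floor_le _) (hy _).symm
  have my2 := Int.lt_floor_add_one (u t 1)
  have mx1 := Int.floor_le (u t 0)
  have mx2 := Int.lt_floor_add_one (u t 0)
  rcases Int.even_or_odd (⌊u t 0⌋ + ⌊u t 1⌋) with hp | hp
  · rcases lt_trichotomy (u t 1 - ⌊u t 1⌋) (u t 0 - ⌊u t 0⌋) with h | h | h
    · exact absurd (not_mem_lower_triangle hδ hu hlen hdark h1 ht hp my1 h) (not_lt.2 mx2.le)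
    · obtain ⟨k, hk⟩ := hp
      refine hd (k - ⌊u t 1⌋) ?_
      have : (⌊u t 0⌋ : ℝ) + ⌊u t 1⌋ = k + k := by exact_mod_cast hk
      push_cast
      linarith
    · exact absurd (not_mem_upper_triangle hδ hu hlen hdark h0 ht hp my2 h) (not_lt.2 mx1)
  · rcases mx1.eq_or_lt with h | h
    · have hp' : Even (⌊u t 0⌋ - 1 + ⌊u t 1⌋) := by
        rw [sub_add_eq_add_sub]; exact hp.sub_odd odd_one
      have := not_mem_lower_triangle hδ hu hlen hdark h1 ht hp' my1 (by push_cast; linarith)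
      push_cast at this
      linarith
    · exact hdark t ht ⟨_, _, hp, ⟨h, mx2⟩, my1, my2⟩

/-- On the net `φ = x + (√2 - 1) y`. This linear form increases at unit rate exactly in the
directions `(1, 0)` and `(1, 1)`, and at least at unit rate only in the cone between them. -/
lemma calibrated_monotone (hδ : IsDarkProfile b δ)
    (hnet : ∀ t ∈ Set.Icc (0 : ℝ) 1,
      (∃ m : ℤ, u t 1 = m) ∨ ∃ k : ℤ, u t 0 - u t 1 = 2 * k)
    (hlen : ∀ s t, 0 ≤ s → s ≤ t → t ≤ 1 →
      ‖u t - u s‖ ≤ calibrationAlong δ u t - calibrationAlong δ u s)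
    {s t : ℝ} (hs : 0 ≤ s) (hst : s ≤ t) (ht : t ≤ 1) :
    u s 1 ≤ u t 1 ∧ u s 0 - u s 1 ≤ u t 0 - u t 1 := by
  have hval : ∀ r ∈ Set.Icc (0 : ℝ) 1, calibrationAlong δ u r = u r 0 + (√2 - 1) * u r 1 := by
    intro r hr
    rw [calibrationAlong]
    rcases hnet r hr with ⟨m, hm⟩ | ⟨k, hk⟩
    · rw [hm, calibration_horizontal hδ]
    · exact calibration_diagonal hδ (k := k) (by linarith)
  have h := hlen s t hs hst ht
  rw [hval s ⟨hs, hst.trans ht⟩, hval t ⟨hs.trans hst, ht⟩, norm_plane, PiLp.sub_apply,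
    PiLp.sub_apply] at h
  obtain ⟨p, hp⟩ : ∃ p, p = u t 0 - u s 0 := ⟨_, rfl⟩
  obtain ⟨q, hq⟩ : ∃ q, q = u t 1 - u s 1 := ⟨_, rfl⟩
  have h' : √(p ^ 2 + q ^ 2) ≤ p + (√2 - 1) * q := by rw [hp, hq]; linarith
  have h2 := Real.sq_sqrt (show (0 : ℝ) ≤ 2 by norm_num)
  have h2' : 1 < √(2 : ℝ) := Real.lt_sqrt_of_sq_lt (by norm_num)
  have hnn : 0 ≤ p + (√2 - 1) * q := (Real.sqrt_nonneg _).trans h'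
  have hsq : p ^ 2 + q ^ 2 ≤ (p + (√2 - 1) * q) ^ 2 := (Real.sqrt_le_iff.1 h').2
  -- The difference of the two sides of `hsq` is `2 (√2 - 1) (p q - q ^ 2)`.
  have hpq : q ^ 2 ≤ p * q := by
    have : (√2 - 1) * (p * q - q ^ 2) ≥ 0 := by nlinarith
    by_contra! hc
    nlinarith
  have hq0 : 0 ≤ q := by
    by_contra! hc
    have : p ≤ q := by by_contra! hc'; nlinarith
    nlinarith
  have hqp : q ≤ p := by
    rcases hq0.eq_or_lt with h0 | h0
    · rw [← h0] at hnn ⊢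
      linarith
    · by_contra! hc'
      nlinarith
  exact ⟨by linarith, by linarith⟩

end

/-! ### Decomposition of a monotone curve on the net into segments. -/

lemma image_Icc_eq_segment {u : ℝ → Plane} {s t : ℝ} (hst : s ≤ t) {φ : ℝ → ℝ} {C v : Plane}
    (hφ : ContinuousOn φ (Set.Icc s t)) (hm : MonotoneOn φ (Set.Icc s t))
    (hu : ∀ r ∈ Set.Icc s t, u r = C + φ r • v) :
    u '' Set.Icc s t = segment ℝ (u s) (u t) := by
  have hs : s ∈ Set.Icc s t := ⟨le_rfl, hst⟩
  have ht : t ∈ Set.Icc s t := ⟨hst, le_rfl⟩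
  have himg : φ '' Set.Icc s t = segment ℝ (φ s) (φ t) := by
    rw [segment_eq_Icc (hm hs ht hst)]
    refine Set.Subset.antisymm ?_ (intermediate_value_Icc hst hφ)
    rintro _ ⟨r, hr, rfl⟩
    exact ⟨hm hs hr hr.1, hm hr ht hr.2⟩
  let L : ℝ →ᵃ[ℝ] Plane := AffineMap.lineMap C (C + v)
  have hL : ∀ r ∈ Set.Icc s t, u r = L (φ r) := by
    intro r hr
    rw [hu r hr, AffineMap.lineMap_apply_module', add_sub_cancel_left, add_comm]
  rw [hL s hs, hL t ht, ← image_segment, ← himg, Set.image_image]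
  exact Set.image_congr hL

/-- A nondecreasing continuous function with integer values inside an interval is constant. -/
lemma const_of_int_on_Ioo {f : ℝ → ℝ} {s t : ℝ} (hst : s < t) (hf : ContinuousOn f (Set.Icc s t))
    (hm : MonotoneOn f (Set.Icc s t)) (hint : ∀ r ∈ Set.Ioo s t, ∃ m : ℤ, f r = m) :
    ∃ m : ℤ, ∀ r ∈ Set.Icc s t, f r = m := by
  have hs : s ∈ Set.Icc s t := ⟨le_rfl, hst.le⟩
  have ht : t ∈ Set.Icc s t := ⟨hst.le, le_rfl⟩
  have heq : f s = f t := by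
    refine (hm hs ht hst.le).eq_of_not_lt fun hlt => ?_
    obtain ⟨v, hv1, hv2⟩ := exists_between (lt_min hlt (Int.lt_floor_add_one (f s)))
    have hv3 := hv2.trans_le (min_le_left _ _)
    have hv4 := hv2.trans_le (min_le_right _ _)
    obtain ⟨r, hr, rfl⟩ := intermediate_value_Ioo hst.le hf ⟨hv1, hv3⟩
    obtain ⟨m, hm'⟩ := hint r hr
    exact not_int_of_mem_Ioo hm' ((Int.floor_le (f s)).trans_lt hv1) hv4
  have hconst : ∀ r ∈ Set.Icc s t, f r = f s := fun r hr =>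
    le_antisymm ((hm hr ht hr.2).trans heq.ge) (hm hs hr hr.1)
  obtain ⟨m, hm'⟩ := hint ((s + t) / 2) ⟨by linarith, by linarith⟩
  refine ⟨m, fun r hr => ?_⟩
  rw [hconst r hr, ← hm']
  exact (hconst _ ⟨by linarith, by linarith⟩).symm

lemma exists_level_interval {g : ℝ → ℝ} (hg : ContinuousOn g (Set.Icc 0 1)) {v : ℝ}
    (h0 : g 0 ≤ v) (h1 : v ≤ g 1) :
    ∃ s t, 0 ≤ s ∧ s ≤ t ∧ t ≤ 1 ∧ g s = v ∧ g t = v ∧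
      ∀ r ∈ Set.Icc (0 : ℝ) 1, g r = v → r ∈ Set.Icc s t := by
  have hcl := hg.preimage_isClosed_of_isClosed isClosed_Icc (isClosed_singleton (x := v))
  have hcomp := isCompact_Icc.of_isClosed_subset hcl Set.inter_subset_left
  obtain ⟨r, hr, hrv⟩ := intermediate_value_Icc zero_le_one hg ⟨h0, h1⟩
  obtain ⟨s, hs, hs'⟩ := hcomp.exists_isLeast ⟨r, hr, hrv⟩
  obtain ⟨t, ht, ht'⟩ := hcomp.exists_isGreatest ⟨r, hr, hrv⟩
  exact ⟨s, t, hs.1.1, hs' ht, ht.1.2, hs.2, ht.2, fun q hq hqv => ⟨hs' ⟨hq, hqv⟩, ht' ⟨hq, hqv⟩⟩⟩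

/-- The structure of a curve on the net that is nondecreasing in the coordinates `y` and `x - y`. -/
lemma structure_of_monotone {u : ℝ → Plane} {n j : ℕ} (hu : ContinuousOn u (Set.Icc 0 1))
    (h0 : u 0 = !₂[(0 : ℝ), 0]) (h1 : u 1 = !₂[2 * (n : ℝ) + j, (j : ℝ)])
    (hnet : ∀ t ∈ Set.Icc (0 : ℝ) 1,
      (∃ m : ℤ, u t 1 = m) ∨ ∃ k : ℤ, u t 0 - u t 1 = 2 * k)
    (hmono : ∀ s t, 0 ≤ s → s ≤ t → t ≤ 1 →
      u s 1 ≤ u t 1 ∧ u s 0 - u s 1 ≤ u t 0 - u t 1) :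
    ∃ A B : ℕ → Plane,
      A 0 = !₂[(0 : ℝ), 0] ∧ B n = !₂[2 * (n : ℝ) + j, (j : ℝ)] ∧
      (∀ k ≤ n,
        u '' Set.Icc 0 1 ∩ lightDiagonal k = segment ℝ (A k) (B k) ∧
        0 ≤ A k 1 ∧ A k 1 ≤ B k 1 ∧ B k 1 ≤ j ∧
        IsLightVertex (A k) ∧ IsLightVertex (B k)) ∧
      (∀ k < n, B k 1 = A (k + 1) 1 ∧ segment ℝ (B k) (A (k + 1)) ⊆ u '' Set.Icc 0 1) ∧
      u '' Set.Icc 0 1 = (⋃ k ∈ Set.Iic n, segment ℝ (A k) (B k)) ∪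
        ⋃ k ∈ Set.Iio n, segment ℝ (B k) (A (k + 1)) := by
  have hyc : ContinuousOn (fun t => u t 1) (Set.Icc 0 1) :=
    (by fun_prop : Continuous fun P : Plane => P 1).comp_continuousOn hu
  have hgc : ContinuousOn (fun t => u t 0 - u t 1) (Set.Icc 0 1) :=
    (by fun_prop : Continuous fun P : Plane => P 0 - P 1).comp_continuousOn hu
  have y0 : u 0 1 = 0 := by rw [h0]; simp
  have y1 : u 1 1 = j := by rw [h1]; simp
  have g0 : u 0 0 - u 0 1 = 0 := by rw [h0]; simp
  have g1 : u 1 0 - u 1 1 = 2 * n := by rw [h1]; simp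
  -- `[s k, t k]` is the time interval spent on the diagonal `D_k`; for `k > n` the values are
  -- arbitrary.
  have hex : ∀ k : ℕ, ∃ s t, k ≤ n → 0 ≤ s ∧ s ≤ t ∧ t ≤ 1 ∧ u s 0 - u s 1 = 2 * k ∧
      u t 0 - u t 1 = 2 * k ∧
      ∀ r ∈ Set.Icc (0 : ℝ) 1, u r 0 - u r 1 = 2 * k → r ∈ Set.Icc s t := by
    intro k
    by_cases hk : k ≤ n
    · have hk' : (k : ℝ) ≤ n := by exact_mod_cast hk
      obtain ⟨s, t, h⟩ := exists_level_interval (v := 2 * k) hgc (by simp [g0])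
        (by simp only [g1]; linarith)
      exact ⟨s, t, fun _ => h⟩
    · exact ⟨0, 0, fun h => absurd h hk⟩
  choose s t hst using hex
  have hs0 : s 0 = 0 := by
    have h := hst 0 (Nat.zero_le n)
    exact le_antisymm (h.2.2.2.2.2 0 ⟨le_rfl, zero_le_one⟩ (by simp [g0])).1 h.1
  have htn : t n = 1 := by
    have h := hst n le_rfl
    exact le_antisymm h.2.2.1 (h.2.2.2.2.2 1 ⟨zero_le_one, le_rfl⟩ g1).2
  have hgap : ∀ k < n, t k < s (k + 1) := by
    intro k hk
    have h := hst k hk.le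
    have h' := hst (k + 1) hk
    by_contra! hc
    have := (hmono _ _ h'.1 hc h.2.2.1).2
    rw [h'.2.2.2.1, h.2.2.2.2.1] at this
    push_cast at this
    linarith
  -- Strictly between `t k` and `s (k + 1)` the value of `x - y` lies strictly between `2 k` and `2
  -- (k + 1)`. No light diagonal is met there, so the ordinate is an integer and therefore constant.
  have hgapy : ∀ k < n, ∃ m : ℤ, ∀ r ∈ Set.Icc (t k) (s (k + 1)), u r 1 = m := by
    intro k hk
    have h := hst k hk.le
    have h' := hst (k + 1) hk
    have hsub : Set.Icc (t k) (s (k + 1)) ⊆ Set.Icc 0 1 :=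
      Set.Icc_subset_Icc (h.1.trans h.2.1) (h'.2.1.trans h'.2.2.1)
    refine const_of_int_on_Ioo (hgap k hk) (hyc.mono hsub)
      (fun a ha b hb hab => (hmono a b (hsub ha).1 hab (hsub hb).2).1) fun r hr => ?_
    have hr01 := hsub (Set.Ioo_subset_Icc_self hr)
    refine (hnet r hr01).resolve_right ?_
    rintro ⟨q, hq⟩
    have m1 := (hmono _ _ (h.1.trans h.2.1) hr.1.le hr01.2).2
    have m2 := (hmono _ _ hr01.1 hr.2.le (h'.2.1.trans h'.2.2.1)).2
    rw [h.2.2.2.2.1, hq] at m1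
    rw [h'.2.2.2.1, hq] at m2
    have l1 : (k : ℤ) ≤ q := by
      have : (k : ℝ) ≤ q := by linarith
      exact_mod_cast this
    have l2 : q ≤ k + 1 := by
      have : (q : ℝ) ≤ (k + 1 : ℕ) := by linarith
      exact_mod_cast this
    rcases l1.eq_or_lt with e | e
    · have := (h.2.2.2.2.2 r hr01 (by rw [hq, ← e]; push_cast; rfl)).2
      linarith [hr.1]
    · have e' : q = k + 1 := by omega
      have := (h'.2.2.2.2.2 r hr01 (by rw [hq, e']; push_cast; rfl)).1
      linarith [hr.2]
  have hAint : ∀ k ≤ n, ∃ m : ℤ, u (s k) 1 = m := by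
    intro k hk
    cases k with
    | zero => exact ⟨0, by rw [hs0, y0]; simp⟩
    | succ k =>
      obtain ⟨m, hm⟩ := hgapy k hk
      exact ⟨m, hm _ ⟨(hgap k hk).le, le_rfl⟩⟩
  have hBint : ∀ k ≤ n, ∃ m : ℤ, u (t k) 1 = m := by
    intro k hk
    rcases hk.eq_or_lt with rfl | hk
    · exact ⟨j, by rw [htn, y1]; simp⟩
    · obtain ⟨m, hm⟩ := hgapy k hk
      exact ⟨m, hm _ ⟨le_rfl, (hgap k hk).le⟩⟩
  have hvert : ∀ (P : Plane) (k : ℕ), P 0 - P 1 = 2 * k → (∃ m : ℤ, P 1 = m) →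
      IsLightVertex P := by
    rintro P k hP ⟨m, hm⟩
    refine ⟨⟨m + 2 * k, m, ?_, hm⟩, k, ?_⟩
    · push_cast; linarith
    · change P 1 = P 0 - 2 * ((k : ℤ) : ℝ)
      push_cast; linarith
  have hlevel : ∀ k ≤ n, ∀ r ∈ Set.Icc (s k) (t k), u r 0 - u r 1 = 2 * k := by
    intro k hk r hr
    have h := hst k hk
    have m1 := (hmono _ _ h.1 hr.1 (hr.2.trans h.2.2.1)).2
    have m2 := (hmono _ _ (h.1.trans hr.1) hr.2 h.2.2.1).2
    rw [h.2.2.2.1] at m1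
    rw [h.2.2.2.2.1] at m2
    exact le_antisymm m2 m1
  have hdiag : ∀ k ≤ n, u '' Set.Icc (s k) (t k) = segment ℝ (u (s k)) (u (t k)) := by
    intro k hk
    have h := hst k hk
    have hsub : Set.Icc (s k) (t k) ⊆ Set.Icc 0 1 := Set.Icc_subset_Icc h.1 h.2.2.1
    refine image_Icc_eq_segment (φ := fun r => u r 1) (C := !₂[2 * (k : ℝ), 0])
      (v := !₂[(1 : ℝ), 1]) h.2.1 (hyc.mono hsub)
      (fun a ha b hb hab => (hmono a b (hsub ha).1 hab (hsub hb).2).1) fun r hr => ?_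
    have := hlevel k hk r hr
    ext i
    fin_cases i
    · simp; linarith
    · simp
  have hhor : ∀ k < n, u '' Set.Icc (t k) (s (k + 1)) = segment ℝ (u (t k)) (u (s (k + 1))) := by
    intro k hk
    have h := hst k hk.le
    have h' := hst (k + 1) hk
    have hsub : Set.Icc (t k) (s (k + 1)) ⊆ Set.Icc 0 1 :=
      Set.Icc_subset_Icc (h.1.trans h.2.1) (h'.2.1.trans h'.2.2.1)
    obtain ⟨m, hm⟩ := hgapy k hk
    refine image_Icc_eq_segment (φ := fun r => u r 0 - u r 1) (C := !₂[(m : ℝ), m])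
      (v := !₂[(1 : ℝ), 0]) (hgap k hk).le (hgc.mono hsub)
      (fun a ha b hb hab => (hmono a b (hsub ha).1 hab (hsub hb).2).2) fun r hr => ?_
    have := hm r hr
    ext i
    fin_cases i
    · simp; linarith
    · simp [this]
  have hsubD : ∀ k ≤ n, segment ℝ (u (s k)) (u (t k)) ⊆ u '' Set.Icc 0 1 := by
    intro k hk
    rw [← hdiag k hk]
    exact Set.image_mono (Set.Icc_subset_Icc (hst k hk).1 (hst k hk).2.2.1)
  have hsubH : ∀ k < n, segment ℝ (u (t k)) (u (s (k + 1))) ⊆ u '' Set.Icc 0 1 := by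
    intro k hk
    rw [← hhor k hk]
    have h := hst k hk.le
    have h' := hst (k + 1) hk
    exact Set.image_mono (Set.Icc_subset_Icc (h.1.trans h.2.1) (h'.2.1.trans h'.2.2.1))
  refine ⟨fun k => u (s k), fun k => u (t k), ?_, ?_, fun k hk => ⟨?_, ?_, ?_, ?_, ?_, ?_⟩,
    fun k hk => ⟨?_, hsubH k hk⟩, Set.Subset.antisymm ?_ ?_⟩
  · simp only [hs0, h0]
  · simp only [htn, h1]
  · rw [← hdiag k hk]
    have h := hst k hk
    ext P
    constructor
    · rintro ⟨⟨r, hr, rfl⟩, hP⟩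
      change u r 1 = u r 0 - 2 * ((k : ℤ) : ℝ) at hP
      push_cast at hP
      exact ⟨r, h.2.2.2.2.2 r hr (by linarith), rfl⟩
    · rintro ⟨r, hr, rfl⟩
      refine ⟨⟨r, ⟨h.1.trans hr.1, hr.2.trans h.2.2.1⟩, rfl⟩, ?_⟩
      have := hlevel k hk r hr
      change u r 1 = u r 0 - 2 * ((k : ℤ) : ℝ)
      push_cast
      linarith
  · have h := hst k hk
    have := (hmono 0 (s k) le_rfl h.1 (h.2.1.trans h.2.2.1)).1
    rwa [y0] at this
  · have h := hst k hk
    exact (hmono _ _ h.1 h.2.1 h.2.2.1).1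
  · have h := hst k hk
    have := (hmono (t k) 1 (h.1.trans h.2.1) h.2.2.1 le_rfl).1
    rwa [y1] at this
  · exact hvert _ k (hst k hk).2.2.2.1 (hAint k hk)
  · exact hvert _ k (hst k hk).2.2.2.2.1 (hBint k hk)
  · obtain ⟨m, hm⟩ := hgapy k hk
    exact (hm _ ⟨le_rfl, (hgap k hk).le⟩).trans (hm _ ⟨(hgap k hk).le, le_rfl⟩).symm
  · rintro _ ⟨r, hr, rfl⟩
    have r0 := (hmono 0 r le_rfl hr.1 hr.2).2
    have r1 := (hmono r 1 hr.1 hr.2 le_rfl).2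
    rw [g0] at r0
    rw [g1] at r1
    -- `k` is the index of the last diagonal reached: equality in `k1` places the point on `D_k`,
    -- strict inequality on the horizontal piece after it.
    obtain ⟨k, hk⟩ : ∃ k, k = ⌊(u r 0 - u r 1) / 2⌋₊ := ⟨_, rfl⟩
    have k1 : (k : ℝ) ≤ (u r 0 - u r 1) / 2 := by rw [hk]; exact Nat.floor_le (by linarith)
    have k2 : (u r 0 - u r 1) / 2 < k + 1 := by rw [hk]; exact Nat.lt_floor_add_one _
    have hkn : k ≤ n := by
      have : (k : ℝ) ≤ n := by linarith
      exact_mod_cast this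
    rcases k1.eq_or_lt with e | e
    · refine Or.inl (Set.mem_iUnion₂.2 ⟨k, hkn, ?_⟩)
      rw [← hdiag k hkn]
      exact ⟨r, (hst k hkn).2.2.2.2.2 r hr (by linarith), rfl⟩
    · have hkn' : k < n := by
        have : (k : ℝ) < n := by linarith
        exact_mod_cast this
      refine Or.inr (Set.mem_iUnion₂.2 ⟨k, hkn', ?_⟩)
      rw [← hhor k hkn']
      have h := hst k hkn
      have h' := hst (k + 1) hkn'
      refine ⟨r, ⟨?_, ?_⟩, rfl⟩
      · by_contra! hc
        have := (hmono r (t k) hr.1 hc.le h.2.2.1).2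
        rw [h.2.2.2.2.1] at this
        linarith
      · by_contra! hc
        have := (hmono (s (k + 1)) r h'.1 hc.le hr.2).2
        rw [h'.2.2.2.1] at this
        push_cast at this
        linarith
  · exact Set.union_subset (Set.iUnion₂_subset hsubD) (Set.iUnion₂_subset hsubH)

/-! ### The competitor: a diagonal followed by a horizontal segment. -/

/-- The curve that runs along the segment `[0, e]` and then along `[e, e + f]`. -/
noncomputable def elbow (e f : Plane) (t : ℝ) : Plane :=
  (2 * min t (1 / 2)) • e + (2 * max t (1 / 2) - 1) • f

lemma elbow_of_le (e f : Plane) {t : ℝ} (ht : t ≤ 1 / 2) : elbow e f t = (2 * t) • e := by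
  rw [elbow, min_eq_left ht, max_eq_right ht]
  norm_num

lemma elbow_of_ge (e f : Plane) {t : ℝ} (ht : 1 / 2 ≤ t) :
    elbow e f t = e + (2 * t - 1) • f := by
  rw [elbow, min_eq_right ht, max_eq_left ht]
  norm_num

lemma isCurve_elbow (e f : Plane) : IsCurve 0 (e + f) (elbow e f) where
  absolutelyContinuous := by
    have hid : AbsolutelyContinuousOnInterval (fun t : ℝ => t) 0 1 :=
      LipschitzOnWith.absolutelyContinuousOnInterval (LipschitzWith.id.lipschitzOnWith)
    refine absolutelyContinuousOnInterval_of_dist_le (C := 2 * ‖e‖ + 2 * ‖f‖) hid fun s t => ?_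
    have h1 : |min s (1 / 2) - min t (1 / 2)| ≤ |s - t| := by
      have := abs_min_sub_min_le_max s (1 / 2) t (1 / 2)
      simpa using this
    have h2 : |max s (1 / 2) - max t (1 / 2)| ≤ |s - t| := by
      have := abs_max_sub_max_le_max s (1 / 2) t (1 / 2)
      simpa using this
    have h3 : elbow e f s - elbow e f t = (2 * (min s (1 / 2) - min t (1 / 2))) • e +
        (2 * (max s (1 / 2) - max t (1 / 2))) • f := by
      rw [elbow, elbow]; module
    rw [dist_eq_norm, h3, Real.dist_eq]
    refine (norm_add_le _ _).trans ?_
    rw [norm_smul, norm_smul, norm_mul, norm_mul, Real.norm_eq_abs, Real.norm_eq_abs,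
      Real.norm_eq_abs, abs_two]
    have := mul_le_mul_of_nonneg_right h1 (norm_nonneg e)
    have := mul_le_mul_of_nonneg_right h2 (norm_nonneg f)
    linarith
  source := by rw [elbow_of_le e f (by norm_num)]; simp
  target := by rw [elbow_of_ge e f (by norm_num)]; norm_num

lemma opticalLength_elbow_le {β : ℝ} (hβ : 1 ≤ β) {e f : Plane}
    (he : ∀ r : ℝ, r • e ∉ darkRegion) (hf : ∀ r : ℝ, e + r • f ∉ darkRegion) :
    opticalLength β (elbow e f) ≤ ‖e‖ + ‖f‖ := by
  have hac := (isCurve_elbow e f).absolutelyContinuous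
  have hac1 := hac.mono (c := 0) (d := 1 / 2) (by
    rw [Set.uIcc_of_le (by norm_num), Set.uIcc_of_le (by norm_num)]
    exact Set.Icc_subset_Icc le_rfl (by norm_num))
  have hac2 := hac.mono (c := 1 / 2) (d := 1) (by
    rw [Set.uIcc_of_le (by norm_num), Set.uIcc_of_le (by norm_num)]
    exact Set.Icc_subset_Icc (by norm_num) le_rfl)
  have i1 := intervalIntegrable_opticalSpeed (by norm_num) hac1 hβ
  have i2 := intervalIntegrable_opticalSpeed (by norm_num) hac2 hβ
  rw [opticalLength, ← intervalIntegral.integral_add_adjacent_intervals i1 i2]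
  have e1 : ∫ t in (0 : ℝ)..1 / 2, refractiveIndex β (elbow e f t) * ‖deriv (elbow e f) t‖ ≤
      ∫ _ in (0 : ℝ)..1 / 2, 2 * ‖e‖ := by
    refine intervalIntegral.integral_mono_on_of_le_Ioo (by norm_num) i1
      intervalIntegrable_const fun t ht => ?_
    have hd : HasDerivAt (elbow e f) ((2 : ℝ) • e) t := by
      have h : HasDerivAt (fun t : ℝ => (2 * t) • e) (((2 : ℝ) * 1) • e) t :=
        ((hasDerivAt_id t).const_mul 2).smul_const e
      rw [mul_one] at h
      refine h.congr_of_eventuallyEq ?_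
      filter_upwards [Iio_mem_nhds ht.2] with r hr using elbow_of_le e f (le_of_lt hr)
    rw [hd.deriv, elbow_of_le e f ht.2.le, refractiveIndex, if_neg (he _), one_mul, norm_smul]
    norm_num
  have e2 : ∫ t in (1 / 2 : ℝ)..1, refractiveIndex β (elbow e f t) * ‖deriv (elbow e f) t‖ ≤
      ∫ _ in (1 / 2 : ℝ)..1, 2 * ‖f‖ := by
    refine intervalIntegral.integral_mono_on_of_le_Ioo (by norm_num) i2
      intervalIntegrable_const fun t ht => ?_
    have hd : HasDerivAt (elbow e f) ((2 : ℝ) • f) t := by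
      have h : HasDerivAt (fun t : ℝ => e + (2 * t - 1) • f) (((2 : ℝ) * 1) • f) t :=
        ((((hasDerivAt_id t).const_mul 2).sub_const 1).smul_const f).const_add e
      rw [mul_one] at h
      refine h.congr_of_eventuallyEq ?_
      filter_upwards [Ioi_mem_nhds ht.1] with r hr using elbow_of_ge e f (le_of_lt hr)
    rw [hd.deriv, elbow_of_ge e f ht.1.le, refractiveIndex, if_neg (hf _), one_mul, norm_smul]
    norm_num
  rw [intervalIntegral.integral_const, smul_eq_mul] at e1 e2
  linarith

lemma not_mem_darkRegion_of_int {P : Plane} {m : ℤ} (h : P 1 = m) : P ∉ darkRegion := by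
  rintro ⟨i, j, _, _, hj⟩
  exact not_int_of_mem_Ioo h hj.1 hj.2

lemma not_mem_darkRegion_of_eq {P : Plane} (h : P 0 = P 1) : P ∉ darkRegion := by
  rintro ⟨i, j, hp, hi, hj⟩
  rw [h] at hi
  have hi' : ⌊P 1⌋ = i := Int.floor_eq_iff.2 ⟨hi.1.le, hi.2⟩
  have hj' : ⌊P 1⌋ = j := Int.floor_eq_iff.2 ⟨hj.1.le, hj.2⟩
  rw [← hi', ← hj'] at hp
  exact Int.not_even_iff_odd.2 hp ⟨_, rfl⟩

/-- The competitor passes through `(j, j)`; neither of its two supporting lines meets the dark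
region. -/
lemma opticalLength_le_of_minimal {β : ℝ} (hβ : 1 ≤ β) {n j : ℕ} {u : ℝ → Plane}
    (hmin : ∀ v : ℝ → Plane, IsCurve !₂[(0 : ℝ), 0] !₂[2 * (n : ℝ) + j, (j : ℝ)] v →
      opticalLength β u ≤ opticalLength β v) :
    opticalLength β u ≤ √2 * j + 2 * n := by
  have hc := isCurve_elbow !₂[(j : ℝ), j] !₂[2 * (n : ℝ), 0]
  have e0 : (0 : Plane) = !₂[(0 : ℝ), 0] := by
    ext i; fin_cases i <;> simp
  have e1 : !₂[(j : ℝ), j] + !₂[2 * (n : ℝ), 0] = !₂[2 * (n : ℝ) + j, (j : ℝ)] := by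
    ext i; fin_cases i <;> simp [add_comm]
  rw [e0, e1] at hc
  refine (hmin _ hc).trans ((opticalLength_elbow_le hβ (fun r => ?_) fun r => ?_).trans ?_)
  · exact not_mem_darkRegion_of_eq (by simp)
  · exact not_mem_darkRegion_of_int (m := j) (by simp)
  · rw [norm_plane, norm_plane]
    simp [sqrt_sq_add_sq_self, Real.sqrt_sq]

end Chessboard

/-! ### Conclusion. -/

theorem theorem4p1 (β : ℝ) (hβ : Chessboard.criticalBeta 0 < β)
    (n j : ℕ) (hn : 1 ≤ n) (hj : 1 ≤ j) (Γ : Set Chessboard.Plane)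
    (hΓ : Chessboard.IsGeodesic β !₂[(0 : ℝ), 0] !₂[2 * (n : ℝ) + j, (j : ℝ)] Γ) :
    ∃ A B : ℕ → Chessboard.Plane,
      A 0 = !₂[(0 : ℝ), 0] ∧ B n = !₂[2 * (n : ℝ) + j, (j : ℝ)] ∧
      (∀ k ≤ n,
        Γ ∩ Chessboard.lightDiagonal k = segment ℝ (A k) (B k) ∧
        0 ≤ A k 1 ∧ A k 1 ≤ B k 1 ∧ B k 1 ≤ j ∧
        Chessboard.IsLightVertex (A k) ∧ Chessboard.IsLightVertex (B k)) ∧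
      (∀ k < n, B k 1 = A (k + 1) 1 ∧ segment ℝ (B k) (A (k + 1)) ⊆ Γ) ∧
      Γ = (⋃ k ∈ Set.Iic n, segment ℝ (A k) (B k)) ∪
        ⋃ k ∈ Set.Iio n, segment ℝ (B k) (A (k + 1)) := by
  obtain ⟨b, hbβ, hb, hcross⟩ := Chessboard.exists_index_lt hβ
  obtain ⟨δ, hδ⟩ := Chessboard.exists_isDarkProfile hb hcross
  obtain ⟨u, ⟨hac, hu0, hu1⟩, hmin, rfl⟩ := hΓ
  have hlen := Chessboard.opticalLength_le_of_minimal (hb.le.trans hbβ.le) hmin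
  have c0 : Chessboard.calibrationAlong δ u 0 = 0 := by
    have := Chessboard.calibration_horizontal hδ 0 0
    rw [Int.cast_zero] at this
    simp [Chessboard.calibrationAlong, hu0, this]
  have c1 : Chessboard.calibrationAlong δ u 1 = √2 * j + 2 * n := by
    have := Chessboard.calibration_horizontal hδ (2 * (n : ℝ) + j) j
    rw [Int.cast_natCast] at this
    simp only [Chessboard.calibrationAlong, hu1, Matrix.cons_val_zero, Matrix.cons_val_one, this]
    ring
  -- The competitor's length equals the increment of the calibration, so the geodesic is calibrated.
  have hopt : Chessboard.opticalLength β u ≤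
      Chessboard.calibrationAlong δ u 1 - Chessboard.calibrationAlong δ u 0 := by
    rw [c0, c1, sub_zero]; exact hlen
  have hnorm : ∀ s t, 0 ≤ s → s ≤ t → t ≤ 1 →
      ‖u t - u s‖ ≤ Chessboard.calibrationAlong δ u t - Chessboard.calibrationAlong δ u s := by
    intro s t hs hst ht
    have := Chessboard.norm_sub_le_calibrationAlong_sub hb hbβ.le hδ hac hopt hs hst ht zero_le_one
      fun r _ => Chessboard.one_le_refractiveIndex (hb.le.trans hbβ.le) (u r)
    rwa [one_mul] at this
  have hcont := hac.continuousOn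
  rw [Set.uIcc_of_le zero_le_one] at hcont
  have z0 : ∃ m : ℤ, u 0 1 = m := ⟨0, by simp [hu0]⟩
  have z1 : ∃ m : ℤ, u 1 1 = m := ⟨j, by simp [hu1]⟩
  have hnet : ∀ t ∈ Set.Icc (0 : ℝ) 1,
      (∃ m : ℤ, u t 1 = m) ∨ ∃ k : ℤ, u t 0 - u t 1 = 2 * k := fun t ht =>
    Chessboard.mem_net_of_calibrated hδ hcont hnorm
      (fun t ht => Chessboard.not_mem_darkRegion_of_calibrated hb hbβ hδ hac hopt z1 ht) z0 z1 ht
  exact Chessboard.structure_of_monotone hcont hu0 hu1 hnet fun s t hs hst ht =>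
    Chessboard.calibrated_monotone hδ hnet hnorm hs hst ht
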